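/- Let $n\ge 1$, let $S^{2n-1}$ be the unit sphere of $\mathbb{R}^{2n}\subset\mathbb{C}^{2n}$ with Lebesgue (surface) measure $\lambda$, and let $\varphi^t$ $(t\in\mathbb{R})$ be the linear circle action on $\mathbb{R}^{2n}$ and $\mathbb{C}^{2n}$ which maps each pair $(x_{2j-1},x_{2j})$, $1\le j\le n$, to $(\cos(2\pi t)\,x_{2j-1}+\sin(2\pi t)\,x_{2j},\ -\sin(2\pi t)\,x_{2j-1}+\cos(2\pi t)\,x_{2j})$. For $\Delta>0$ let $B_\Delta=\{z\in\mathbb{C}^{2n}:|z|\le\max(\Delta,1)\}$ (thus $\{|z|\le\Delta\}$ when $\Delta\ge1$). A homeomorphism $f$ of $S^{2n-1}$ is a $C^\omega_\Delta$ diffeomorphism if $f$ and $f^{-1}$ extend to $\mathbb{C}^{2n}$-valued maps that are holomorphic on a neighbourhood of $B_\Delta$, and an entire diffeomorphism if both extend to holomorphic maps $\mathbb{C}^{2n}\to\mathbb{C}^{2n}$; such a diffeomorphism is considered together with a choice of these extensions, denoted by the same letters, and compositions and inverses of entire diffeomorphisms are extended by composing, respectively exchanging, the chosen extensions. Put $$|f-g|_\Delta=\max\Big\{\max_{z\in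 B_\Delta}|f(z)-g(z)|,\ \max_{z\in B_\Delta}|f^{-1}(z)-g^{-1}(z)|\Big\}.$$ Then for every $t_0\in[0,1]$, $\varepsilon>0$ and $\Delta>0$ there is a $C^\omega_\Delta$ diffeomorphism $f$ of $S^{2n-1}$ that preserves $\lambda$, is uniquely ergodic (it has exactly one invariant Borel probability measure), hence minimal (every orbit is dense), and satisfies $$|f-\varphi^{t_0}|_\Delta<\varepsilon .$$ Moreover there are entire diffeomorphisms $H_k$ of $S^{2n-1}$ preserving $\lambda$ and numbers $t_k\in\mathbb{R}$ such that $|H_k\circ\varphi^{t_k}\circ H_k^{-1}-f|_\Delta\to0$ as $k\to\infty$. -/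

import Mathlib

open MeasureTheory Filter Topology
open scoped ENNReal

noncomputable section

/-- The Euclidean space `𝕜^{2n}`; the coordinates `x_{2j-1}, x_{2j}` (`1 ≤ j ≤ n`) are
indexed by the pairs `(j, 0), (j, 1)`. -/
abbrev EvenSpace (𝕜 : Type) (n : ℕ) : Type := EuclideanSpace 𝕜 (Fin n × Fin 2)

/-- The unit sphere `S^{2n-1}` in `ℝ^{2n}`. -/
abbrev OddSphere (n : ℕ) : Type := Metric.sphere (0 : EvenSpace ℝ n) 1

/-- Lebesgue (surface) measure on `S^{2n-1}`. -/
def sphereVolume (n : ℕ) : Measure (OddSphere n) :=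
  (volume : Measure (EvenSpace ℝ n)).toSphere

/-- The standard inclusion `ℝ^{2n} ⊂ ℂ^{2n}`. -/
def complexify {n : ℕ} (x : EvenSpace ℝ n) : EvenSpace ℂ n :=
  WithLp.toLp 2 fun i => ((x i : ℝ) : ℂ)

/-- The linear circle action, on `ℝ^{2n}` (`𝕜 = ℝ`) and on `ℂ^{2n}` (`𝕜 = ℂ`): each pair
`(x_{2j-1}, x_{2j})` is sent to
`(cos(2πt) x_{2j-1} + sin(2πt) x_{2j}, -sin(2πt) x_{2j-1} + cos(2πt) x_{2j})`. -/
def planeRotation (𝕜 : Type) [RCLike 𝕜] {n : ℕ} (t : ℝ) (x : EvenSpace 𝕜 n) : EvenSpace 𝕜 n :=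
  WithLp.toLp 2 fun i =>
    if i.2 = 0 then
      (Real.cos (2 * Real.pi * t) : 𝕜) * x (i.1, 0) + (Real.sin (2 * Real.pi * t) : 𝕜) * x (i.1, 1)
    else
      -(Real.sin (2 * Real.pi * t) : 𝕜) * x (i.1, 0) + (Real.cos (2 * Real.pi * t) : 𝕜) * x (i.1, 1)

/-- `F` is holomorphic on an open neighbourhood of `K`. -/
def HolomorphicNear {n : ℕ} (F : EvenSpace ℂ n → EvenSpace ℂ n) (K : Set (EvenSpace ℂ n)) : Prop :=
  ∃ U : Set (EvenSpace ℂ n), IsOpen U ∧ K ⊆ U ∧ DifferentiableOn ℂ F U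

/-- A homeomorphism of `S^{2n-1}` such that it and its inverse are restrictions of maps that are
holomorphic near `K ⊆ ℂ^{2n}`, together with these extensions. (Used for `K` containing the
sphere, where it is therefore a real-analytic diffeomorphism. The extensions are part
of the data because they are not determined by the values on the sphere; the distance below
depends on them.) -/
structure HolDiffeo (n : ℕ) (K : Set (EvenSpace ℂ n)) where
  /-- the map of the sphere -/
  toHomeo : OddSphere n ≃ₜ OddSphere n
  /-- the holomorphic extension of the map -/
  ext : EvenSpace ℂ n → EvenSpace ℂ n
  /-- the holomorphic extension of the inverse -/
  extInv : EvenSpace ℂ n → EvenSpace ℂ n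
  holo_ext : HolomorphicNear ext K
  holo_extInv : HolomorphicNear extInv K
  ext_apply : ∀ x : OddSphere n,
    ext (complexify (x : EvenSpace ℝ n)) = complexify (toHomeo x : EvenSpace ℝ n)
  extInv_apply : ∀ x : OddSphere n,
    extInv (complexify (x : EvenSpace ℝ n)) = complexify (toHomeo.symm x : EvenSpace ℝ n)

/-- Entire diffeomorphisms of `S^{2n-1}`. -/
abbrev EntDiffeo (n : ℕ) : Type := HolDiffeo n Set.univ

/-- The closed ball `B_Δ` of `ℂ^{2n}` on which extensions live; for `Δ < 1`, where this ball would
not contain the sphere, it is replaced by `B_1`. -/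
def extBall (n : ℕ) (Δ : ℝ) : Set (EvenSpace ℂ n) := Metric.closedBall 0 (max Δ 1)

/-- The distance `max (sup_K |f - g|) (sup_K |f⁻¹ - g⁻¹|)`. -/
def holDist {n : ℕ} (K : Set (EvenSpace ℂ n)) {L M : Set (EvenSpace ℂ n)}
    (f : HolDiffeo n L) (g : HolDiffeo n M) : ℝ≥0∞ :=
  max (⨆ z ∈ K, edist (f.ext z) (g.ext z)) (⨆ z ∈ K, edist (f.extInv z) (g.extInv z))

/-- Preservation of the Lebesgue measure of the sphere. -/
def HolDiffeo.VolumePreserving {n : ℕ} {K : Set (EvenSpace ℂ n)} (f : HolDiffeo n K) : Prop :=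
  MeasurePreserving f.toHomeo (sphereVolume n) (sphereVolume n)

/-- Exactly one invariant Borel probability measure. -/
def UniquelyErgodic {X : Type*} [MeasurableSpace X] (f : X → X) : Prop :=
  ∃! μ : Measure X, IsProbabilityMeasure μ ∧ MeasurePreserving f μ μ

/-- Every orbit is dense. -/
def MinimalHomeo {X : Type*} [TopologicalSpace X] (f : X ≃ₜ X) : Prop :=
  ∀ x : X, Dense (Set.range fun k : ℤ => (f ^ k) x)

theorem HolomorphicNear.differentiable {n : ℕ} {F : EvenSpace ℂ n → EvenSpace ℂ n}
    (h : HolomorphicNear F Set.univ) : Differentiable ℂ F := by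
  obtain ⟨U, -, hU, hF⟩ := h
  rw [Set.univ_subset_iff.mp hU] at hF
  exact differentiableOn_univ.mp hF

theorem Differentiable.holomorphicNear {n : ℕ} {F : EvenSpace ℂ n → EvenSpace ℂ n}
    (h : Differentiable ℂ F) (K : Set (EvenSpace ℂ n)) : HolomorphicNear F K :=
  ⟨Set.univ, isOpen_univ, Set.subset_univ K, h.differentiableOn⟩

/-- Composition of entire diffeomorphisms. -/
def EntDiffeo.comp {n : ℕ} (f g : EntDiffeo n) : EntDiffeo n where
  toHomeo := g.toHomeo.trans f.toHomeo
  ext := f.ext ∘ g.ext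
  extInv := g.extInv ∘ f.extInv
  holo_ext := (f.holo_ext.differentiable.comp g.holo_ext.differentiable).holomorphicNear _
  holo_extInv := (g.holo_extInv.differentiable.comp f.holo_extInv.differentiable).holomorphicNear _
  ext_apply x := by simp [g.ext_apply, f.ext_apply]
  extInv_apply x := by simp [g.extInv_apply, f.extInv_apply]

/-- The inverse of an entire diffeomorphism. -/
def EntDiffeo.inv {n : ℕ} (f : EntDiffeo n) : EntDiffeo n where
  toHomeo := f.toHomeo.symm
  ext := f.extInv
  extInv := f.ext
  holo_ext := f.holo_extInv
  holo_extInv := f.holo_ext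
  ext_apply x := f.extInv_apply x
  extInv_apply x := f.ext_apply x

theorem norm_planeRotation {n : ℕ} (t : ℝ) (x : EvenSpace ℝ n) : ‖planeRotation ℝ t x‖ = ‖x‖ := by
  rw [EuclideanSpace.norm_eq, EuclideanSpace.norm_eq]
  congr 1
  rw [Fintype.sum_prod_type, Fintype.sum_prod_type]
  refine Finset.sum_congr rfl fun j _ => ?_
  simp only [Fin.sum_univ_two, Real.norm_eq_abs, sq_abs, planeRotation]
  simp
  linear_combination (x (j, 0) ^ 2 + x (j, 1) ^ 2) * Real.sin_sq_add_cos_sq (2 * Real.pi * t)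

theorem planeRotation_neg_planeRotation {n : ℕ} (t : ℝ) (x : EvenSpace ℝ n) :
    planeRotation ℝ (-t) (planeRotation ℝ t x) = x := by
  have h := Real.sin_sq_add_cos_sq (2 * Real.pi * t)
  ext ⟨j, k⟩
  fin_cases k
  · simp [planeRotation]
    linear_combination x (j, 0) * h
  · simp [planeRotation]
    linear_combination x (j, 1) * h

theorem continuous_planeRotation {n : ℕ} (t : ℝ) :
    Continuous (planeRotation ℝ t : EvenSpace ℝ n → EvenSpace ℝ n) := by
  unfold planeRotation
  refine (PiLp.continuous_toLp 2 _).comp (continuous_pi fun i => ?_)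
  split_ifs <;> fun_prop

theorem differentiable_planeRotation {n : ℕ} (t : ℝ) :
    Differentiable ℂ (planeRotation ℂ t : EvenSpace ℂ n → EvenSpace ℂ n) := by
  rw [differentiable_euclidean]
  intro i
  simp only [planeRotation]
  split_ifs <;> fun_prop

theorem planeRotation_complexify {n : ℕ} (t : ℝ) (x : EvenSpace ℝ n) :
    planeRotation ℂ t (complexify x) = complexify (planeRotation ℝ t x) := by
  ext i
  simp only [planeRotation, complexify]
  split_ifs <;> simp

theorem mem_sphere_planeRotation {n : ℕ} (t : ℝ) (x : OddSphere n) :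
    planeRotation ℝ t (x : EvenSpace ℝ n) ∈ Metric.sphere (0 : EvenSpace ℝ n) 1 := by
  have h := x.2
  rw [mem_sphere_zero_iff_norm] at h ⊢
  rw [norm_planeRotation, h]

/-- The rotation `φ^t` as a map of the sphere. -/
def sphereRotation {n : ℕ} (t : ℝ) (x : OddSphere n) : OddSphere n :=
  ⟨planeRotation ℝ t (x : EvenSpace ℝ n), mem_sphere_planeRotation t x⟩

theorem sphereRotation_neg {n : ℕ} (t : ℝ) (x : OddSphere n) :
    sphereRotation (-t) (sphereRotation t x) = x :=
  Subtype.ext (planeRotation_neg_planeRotation t (x : EvenSpace ℝ n))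

theorem continuous_sphereRotation {n : ℕ} (t : ℝ) :
    Continuous (sphereRotation t : OddSphere n → OddSphere n) :=
  ((continuous_planeRotation t).comp continuous_subtype_val).subtype_mk _

/-- The rotation `φ^t` as a homeomorphism of the sphere, with inverse `φ^{-t}`. -/
def sphereRotationHomeo (n : ℕ) (t : ℝ) : OddSphere n ≃ₜ OddSphere n where
  toFun := sphereRotation t
  invFun := sphereRotation (-t)
  left_inv := sphereRotation_neg t
  right_inv x := by
    have h := sphereRotation_neg (-t) x
    rwa [neg_neg] at h
  continuous_toFun := continuous_sphereRotation t
  continuous_invFun := continuous_sphereRotation (-t)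

/-- The circle action `φ^t` on `S^{2n-1}`, with its linear extension to `ℂ^{2n}`. -/
def circleFlow (n : ℕ) (t : ℝ) : EntDiffeo n where
  toHomeo := sphereRotationHomeo n t
  ext := planeRotation ℂ t
  extInv := planeRotation ℂ (-t)
  holo_ext := (differentiable_planeRotation t).holomorphicNear _
  holo_extInv := (differentiable_planeRotation (-t)).holomorphicNear _
  ext_apply x := planeRotation_complexify t (x : EvenSpace ℝ n)
  extInv_apply x := planeRotation_complexify (-t) (x : EvenSpace ℝ n)

end

/-
Anosov–Katok approximation by conjugation: `f` is a limit of periodic maps `H ∘ φ^α ∘ H⁻¹` with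
`α` rational. If `h` commutes with `φ^α`, then `H` may be replaced by `H ∘ h` without changing the
map, and `h` is chosen so that the mean of a given observable `F ∘ H ∘ h` along every `φ`-orbit is
almost the same number. A small change of `α` then gives orbits that follow the `φ`-orbits, and the
long averages of `F` become almost constant. This property is open, so it passes to the limit for
a dense sequence of observables, which gives unique ergodicity; minimality follows because the
invariant measure has full support.

The conjugations `h` are compositions of shears. For a unit vector `u` the rotation of the
complement of the complex line `ℂu` is a circle action commuting with `φ`; moving `x` along it for
the time `M re (w ^ q)`, where `w` is the coordinate of `x` on `ℂu`, is an entire map with entire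
inverse, it preserves `λ` because `w` is invariant, and it commutes with `φ^α` when the denominator
of `α` divides `q`. For large `q` and `M` the means along `φ`-orbits are averaged over that circle
action. Iterating over several `u` reaches near-constant means, since these circle actions together
with `φ` are transitive on the sphere.
-/

noncomputable section

open AddCircle (toCircle)

local notation "𝕋" => UnitAddCircle

instance isProbabilityMeasure_unitAddCircle : IsProbabilityMeasure (volume : Measure 𝕋) :=
  ⟨UnitAddCircle.measure_univ⟩

theorem integrable_of_continuous {X E : Type*} [TopologicalSpace X] [CompactSpace X]
    [MeasurableSpace X] [OpensMeasurableSpace X] [NormedAddCommGroup E] {μ : Measure X}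
    [IsFiniteMeasureOnCompacts μ] {f : X → E} (hf : Continuous f) : Integrable f μ :=
  hf.integrable_of_hasCompactSupport (HasCompactSupport.of_compactSpace f)

section Equidistribution

theorem mul_integral_comp_mul_eq_of_hasDerivAt {θ θ' θ'' k K : ℝ → ℝ} {a b R : ℝ}
    (hθ : ∀ s ∈ Set.uIcc a b, HasDerivAt θ (θ' s) s)
    (hθ' : ∀ s ∈ Set.uIcc a b, HasDerivAt θ' (θ'' s) s) (hθ'' : ContinuousOn θ'' (Set.uIcc a b))
    (hθ0 : ∀ s ∈ Set.uIcc a b, θ' s ≠ 0) (hk : Continuous k) (hK : ∀ x, HasDerivAt K (k x) x) :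
    R * (∫ s in a..b, k (R * θ s)) = K (R * θ b) / θ' b - K (R * θ a) / θ' a +
      ∫ s in a..b, K (R * θ s) * (θ'' s / θ' s ^ 2) := by
  have hcθ : ContinuousOn θ (Set.uIcc a b) := HasDerivAt.continuousOn hθ
  have hcK : Continuous K := continuous_iff_continuousAt.2 fun x => (hK x).continuousAt
  have hderiv : ∀ s ∈ Set.uIcc a b, HasDerivAt (fun s => K (R * θ s) / θ' s)
      (R * k (R * θ s) - K (R * θ s) * (θ'' s / θ' s ^ 2)) s := fun s hs => by
    have h0 := hθ0 s hs
    refine (((hK _).comp s ((hθ s hs).const_mul R)).div (hθ' s hs) h0).congr_deriv ?_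
    simp only [Function.comp_apply]
    field_simp
  have hk_int : IntervalIntegrable (fun s => R * k (R * θ s)) volume a b :=
    ((hk.comp_continuousOn (hcθ.const_mul R)).const_mul R).intervalIntegrable
  have hK_int : IntervalIntegrable (fun s => K (R * θ s) * (θ'' s / θ' s ^ 2)) volume a b :=
    ((hcK.comp_continuousOn (hcθ.const_mul R)).mul
      (hθ''.div ((HasDerivAt.continuousOn hθ').pow 2) fun s hs =>
        pow_ne_zero 2 (hθ0 s hs))).intervalIntegrable
  rw [← intervalIntegral.integral_const_mul, ← sub_eq_iff_eq_add,
    ← intervalIntegral.integral_sub hk_int hK_int,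
    intervalIntegral.integral_eq_sub_of_hasDerivAt hderiv (hk_int.sub hK_int)]

theorem abs_integral_comp_mul_le_of_le_abs_deriv {θ θ' θ'' k K : ℝ → ℝ} {a b σ D B R : ℝ}
    (hab : a ≤ b) (hθ : ∀ s ∈ Set.Icc a b, HasDerivAt θ (θ' s) s)
    (hθ' : ∀ s ∈ Set.Icc a b, HasDerivAt θ' (θ'' s) s) (hθ'' : ContinuousOn θ'' (Set.Icc a b))
    (hσ : 0 < σ) (hσθ : ∀ s ∈ Set.Icc a b, σ ≤ |θ' s|) (hD : ∀ s ∈ Set.Icc a b, |θ'' s| ≤ D)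
    (hk : Continuous k) (hK : ∀ x, HasDerivAt K (k x) x) (hB : ∀ x, |K x| ≤ B) (hR : 0 < R) :
    |∫ s in a..b, k (R * θ s)| ≤ (2 / σ + (b - a) * D / σ ^ 2) * B / R := by
  have hB0 : 0 ≤ B := (abs_nonneg _).trans (hB 0)
  have hθ0 : ∀ s ∈ Set.Icc a b, θ' s ≠ 0 := fun s hs => abs_pos.1 (hσ.trans_le (hσθ s hs))
  have hboundary : ∀ s ∈ Set.Icc a b, |K (R * θ s) / θ' s| ≤ B / σ := fun s hs => by
    rw [abs_div]
    exact div_le_div₀ hB0 (hB _) hσ (hσθ s hs)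
  have hremainder : |∫ s in a..b, K (R * θ s) * (θ'' s / θ' s ^ 2)| ≤
      B * (D / σ ^ 2) * |b - a| :=
    intervalIntegral.norm_integral_le_of_norm_le_const
        (f := fun s => K (R * θ s) * (θ'' s / θ' s ^ 2)) fun s hs => by
      have hs := Set.Ioc_subset_Icc_self (Set.uIoc_of_le hab ▸ hs)
      rw [Real.norm_eq_abs, abs_mul, abs_div, abs_pow]
      have := (abs_nonneg _).trans (hD s hs)
      gcongr
      exacts [hB _, hD s hs, hσθ s hs]
  rw [abs_of_nonneg (sub_nonneg.2 hab)] at hremainder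
  rw [le_div_iff₀ hR, mul_comm, ← abs_of_pos hR, ← abs_mul, abs_of_pos hR]
  rw [← Set.uIcc_of_le hab] at hθ hθ' hθ'' hθ0
  rw [mul_integral_comp_mul_eq_of_hasDerivAt hθ hθ' hθ'' hθ0 hk hK]
  calc _ ≤ B / σ + B / σ + B * (D / σ ^ 2) * (b - a) :=
        (abs_add_le _ _).trans (add_le_add ((abs_sub _ _).trans (add_le_add
          (hboundary b ⟨hab, le_rfl⟩) (hboundary a ⟨le_rfl, hab⟩))) hremainder)
    _ = (2 / σ + (b - a) * D / σ ^ 2) * B := by ring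

theorem exists_abs_integral_comp_cos_le {δ : ℝ} (hδ : 0 < δ) (hδ' : δ < 1 / 4) :
    ∃ C : ℝ, ∀ (k K : ℝ → ℝ) (B R : ℝ), Continuous k → (∀ x, HasDerivAt K (k x) x) →
      (∀ x, |K x| ≤ B) → 0 < R →
      |∫ s in δ..(1 / 2 - δ), k (R * Real.cos (2 * Real.pi * s))| ≤ C * B / R := by
  have hpi := Real.pi_pos
  have hsin : ∀ s ∈ Set.Icc δ (1 / 2 - δ), 0 < Real.sin (2 * Real.pi * s) := fun s hs =>
    Real.sin_pos_of_pos_of_lt_pi (by have := hδ.trans_le hs.1; positivity)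
      (by have := hs.2; nlinarith)
  obtain ⟨σ, hσ, hσs⟩ := isCompact_Icc.exists_forall_le' (a := (0 : ℝ))
    (f := fun s => Real.sin (2 * Real.pi * s)) (by fun_prop) hsin
  have hlin : ∀ s : ℝ, HasDerivAt (fun s => 2 * Real.pi * s) (2 * Real.pi) s := fun s => by
    simpa using (hasDerivAt_id s).const_mul (2 * Real.pi)
  refine ⟨_, fun k K B R hk hK hKB hR => abs_integral_comp_mul_le_of_le_abs_deriv
    (σ := 2 * Real.pi * σ) (D := (2 * Real.pi) ^ 2) (by linarith)
    (fun s _ => (Real.hasDerivAt_cos _).comp s (hlin s))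
    (fun s _ => (((Real.hasDerivAt_sin _).comp s (hlin s)).neg.mul_const (2 * Real.pi)))
    (by fun_prop) (by positivity) (fun s hs => ?_) (fun s _ => ?_) hk hK hKB hR⟩
  · rw [abs_mul, abs_neg, abs_of_pos (hsin s hs), abs_of_pos (by positivity), mul_comm]
    gcongr
    exact hσs s hs
  · rw [abs_mul, abs_neg, abs_mul, abs_of_pos (show 0 < 2 * Real.pi by positivity), mul_assoc,
      ← sq]
    exact mul_le_of_le_one_left (by positivity) (Real.abs_cos_le_one _)

theorem exists_forall_abs_integral_comp_cos_le (B : ℝ) {ε : ℝ} (hε : 0 < ε) :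
    ∃ R₀ : ℝ, 0 < R₀ ∧ ∀ (k K : ℝ → ℝ) (R : ℝ), Continuous k → (∀ x, |k x| ≤ B) →
      (∀ x, HasDerivAt K (k x) x) → (∀ x, |K x| ≤ B) → R₀ ≤ R →
      |∫ s in (0 : ℝ)..(1 / 2), k (R * Real.cos (2 * Real.pi * s))| ≤ ε := by
  obtain hB | hB := lt_or_ge B 0
  · exact ⟨1, one_pos, fun k K R _ hk => absurd ((abs_nonneg _).trans (hk 0)) hB.not_ge⟩
  obtain ⟨δ, hδ, hδε, hδ4⟩ : ∃ δ : ℝ, 0 < δ ∧ B * δ ≤ ε / 4 ∧ δ < 1 / 4 := by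
    refine ⟨min (1 / 8) (ε / (4 * (B + 1))), by positivity, ?_,
      (min_le_left _ _).trans_lt (by norm_num)⟩
    calc B * min (1 / 8) (ε / (4 * (B + 1))) ≤ (B + 1) * (ε / (4 * (B + 1))) := by
          gcongr
          · linarith
          · exact min_le_right _ _
      _ = ε / 4 := by field_simp
  obtain ⟨C, hC⟩ := exists_abs_integral_comp_cos_le hδ hδ4
  refine ⟨2 * |C| * B / ε + 1, by positivity, fun k K R hk hkB hK hKB hR => ?_⟩
  have hR0 : 0 < R := lt_of_lt_of_le (by positivity) hR
  have hg : ∀ a b, IntervalIntegrable (fun s => k (R * Real.cos (2 * Real.pi * s))) volume a b :=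
    fun a b => Continuous.intervalIntegrable (by fun_prop) a b
  have hstart := intervalIntegral.norm_integral_le_of_norm_le_const (a := 0) (b := δ)
    (f := fun s => k (R * Real.cos (2 * Real.pi * s))) fun s _ => hkB _
  have hend := intervalIntegral.norm_integral_le_of_norm_le_const (a := 1 / 2 - δ) (b := 1 / 2)
    (f := fun s => k (R * Real.cos (2 * Real.pi * s))) fun s _ => hkB _
  rw [Real.norm_eq_abs, sub_zero, abs_of_pos hδ] at hstart
  rw [Real.norm_eq_abs, sub_sub_cancel, abs_of_pos hδ] at hend
  have hmiddle : C * B / R ≤ ε / 2 := by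
    have hR' : 2 * |C| * B / ε ≤ R := (lt_add_one _).le.trans hR
    rw [div_le_iff₀ hε] at hR'
    rw [div_le_iff₀ hR0]
    linarith [mul_le_mul_of_nonneg_right (le_abs_self C) hB]
  rw [← intervalIntegral.integral_add_adjacent_intervals (hg 0 δ) (hg δ (1 / 2)),
    ← intervalIntegral.integral_add_adjacent_intervals (hg δ (1 / 2 - δ)) (hg _ (1 / 2))]
  calc _ ≤ B * δ + (C * B / R + B * δ) :=
        (abs_add_le _ _).trans (add_le_add hstart ((abs_add_le _ _).trans (add_le_add
          (hC k K B R hk hK hKB hR0) hend)))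
    _ ≤ ε := by linarith

theorem exists_primitive_abs_le {k : ℝ → ℝ} {T B : ℝ} (hT : 0 < T) (hk : Continuous k)
    (hper : Function.Periodic k T) (hmean : ∫ s in (0 : ℝ)..T, k s = 0) (hB : ∀ x, |k x| ≤ B) :
    ∃ K : ℝ → ℝ, (∀ x, HasDerivAt K (k x) x) ∧ ∀ x, |K x| ≤ B * T := by
  have hint : ∀ a b, IntervalIntegrable k volume a b := fun a b => hk.intervalIntegrable a b
  refine ⟨fun x => ∫ s in (0 : ℝ)..x, k s, fun x =>
    intervalIntegral.integral_hasDerivAt_right (hint _ _) (hk.stronglyMeasurableAtFilter _ _)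
      hk.continuousAt, fun x => ?_⟩
  have hKper : Function.Periodic (fun x => ∫ s in (0 : ℝ)..x, k s) T := fun x => by
    simp only [← intervalIntegral.integral_add_adjacent_intervals (hint 0 x) (hint x (x + T)),
      hper.intervalIntegral_add_eq x 0, zero_add, hmean, add_zero]
  obtain ⟨y, hy, hxy⟩ := hKper.exists_mem_Ico₀ hT x
  have hB0 : 0 ≤ B := (abs_nonneg _).trans (hB 0)
  calc |∫ s in (0 : ℝ)..x, k s| = |∫ s in (0 : ℝ)..y, k s| := by rw [hxy]
    _ ≤ B * |y - 0| :=
      intervalIntegral.norm_integral_le_of_norm_le_const (f := k) fun s _ => hB s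
    _ ≤ B * T := by
      rw [sub_zero, abs_of_nonneg hy.1]
      gcongr
      exact hy.2.le

theorem integral_comp_re_mul_toCircle (k : ℝ → ℝ) (c : ℂ) :
    ∫ t : 𝕋, k (c * toCircle t).re =
      ∫ s in (-(1 / 2) : ℝ)..(1 / 2), k (‖c‖ * Real.cos (2 * Real.pi * s)) := by
  have hre : ∀ s : ℝ, ((‖c‖ : ℂ) * (toCircle (s : 𝕋) : ℂ)).re =
      ‖c‖ * Real.cos (2 * Real.pi * s) := fun s => by
    rw [Complex.re_ofReal_mul, AddCircle.toCircle_apply_mk, Circle.coe_exp,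
      Complex.exp_ofReal_mul_I_re, div_one]
  have harg : (toCircle ((c.arg / (2 * Real.pi) : ℝ) : 𝕋) : ℂ) =
      Complex.exp (c.arg * Complex.I) := by
    rw [AddCircle.toCircle_apply_mk, Circle.coe_exp]
    congr 3
    field_simp
  calc ∫ t : 𝕋, k (c * toCircle t).re
      = ∫ t : 𝕋,
          k (‖c‖ * (toCircle (t + (c.arg / (2 * Real.pi) : ℝ) : 𝕋) : ℂ)).re := by
        refine integral_congr_ae (.of_forall fun t => ?_)
        simp only [AddCircle.toCircle_add, Circle.coe_mul, harg]
        rw [mul_comm (toCircle t : ℂ), ← mul_assoc, Complex.norm_mul_exp_arg_mul_I]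
    _ = ∫ t : 𝕋, k (‖c‖ * (toCircle t : ℂ)).re :=
        integral_add_right_eq_self
          (fun t : 𝕋 => k (‖c‖ * (toCircle t : ℂ)).re) _
    _ = ∫ s in (-(1 / 2) : ℝ)..(-(1 / 2) + 1), k (‖c‖ * Real.cos (2 * Real.pi * s)) := by
        simp only [← UnitAddCircle.intervalIntegral_preimage (-(1 / 2)), hre]
    _ = _ := by norm_num

theorem integral_comp_re_mul_toCircle_eq_two_mul {k : ℝ → ℝ} (hk : Continuous k) (c : ℂ) :
    ∫ t : 𝕋, k (c * toCircle t).re =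
      2 * ∫ s in (0 : ℝ)..(1 / 2), k (‖c‖ * Real.cos (2 * Real.pi * s)) := by
  have hint : ∀ a b,
      IntervalIntegrable (fun s => k (‖c‖ * Real.cos (2 * Real.pi * s))) volume a b :=
    fun a b => Continuous.intervalIntegrable (by fun_prop) a b
  have heven : ∫ s in (-(1 / 2) : ℝ)..0, k (‖c‖ * Real.cos (2 * Real.pi * s)) =
      ∫ s in (0 : ℝ)..(1 / 2), k (‖c‖ * Real.cos (2 * Real.pi * s)) := by
    rw [← neg_zero, ← intervalIntegral.integral_comp_neg, neg_zero]
    simp only [mul_neg, Real.cos_neg]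
  rw [integral_comp_re_mul_toCircle,
    ← intervalIntegral.integral_add_adjacent_intervals (hint _ 0) (hint 0 _), heven,
    ← two_mul]

/- Integrating by parts against a primitive of `k - ∫ k` uses nothing about `k` but its bound, so
the rate is uniform over all observables bounded by `B`. -/
theorem exists_forall_abs_integral_re_mul_toCircle_sub_le (B : ℝ) {ε : ℝ} (hε : 0 < ε) :
    ∃ R₀ : ℝ, 0 < R₀ ∧ ∀ (k : 𝕋 → ℝ) (c : ℂ), Continuous k → (∀ s, |k s| ≤ B) →
      R₀ ≤ ‖c‖ →
      |(∫ s : 𝕋, k ((c * toCircle s).re : ℝ)) - ∫ s : 𝕋, k s| ≤ ε := by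
  obtain ⟨R₀, hR₀, hosc⟩ := exists_forall_abs_integral_comp_cos_le (2 * B) (half_pos hε)
  refine ⟨R₀, hR₀, fun k c hk hB hc => ?_⟩
  set m := ∫ s : 𝕋, k s with hm
  have hmB : |m| ≤ B := by
    simpa using norm_integral_le_of_norm_le_const (μ := (volume : Measure 𝕋))
      (f := k) (.of_forall hB)
  set k₀ : ℝ → ℝ := fun x => k x - m with hk₀
  have hk₀c : Continuous k₀ := (hk.comp (AddCircle.continuous_mk' 1)).sub continuous_const
  have hk₀B : ∀ x, |k₀ x| ≤ 2 * B := fun x => (abs_sub _ _).trans (by linarith [hB x])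
  have hk₀m : ∫ s in (0 : ℝ)..1, k₀ s = 0 := by
    have hk' : Continuous fun x : ℝ => k x := hk.comp (AddCircle.continuous_mk' 1)
    have hkm := UnitAddCircle.intervalIntegral_preimage 0 k
    rw [zero_add] at hkm
    rw [intervalIntegral.integral_sub (hk'.intervalIntegrable _ _) intervalIntegrable_const, hkm]
    simp [hm]
  obtain ⟨K, hK, hKB⟩ := exists_primitive_abs_le one_pos hk₀c
    (fun x => by simp [hk₀]) hk₀m hk₀B
  have hsub : (∫ s : 𝕋, k ((c * toCircle s).re : ℝ)) - m =
      ∫ s : 𝕋, k₀ (c * toCircle s).re := by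
    rw [integral_sub, integral_const]
    · simp
    · exact integrable_of_continuous (hk.comp ((AddCircle.continuous_mk' 1).comp
        (Complex.continuous_re.comp (continuous_const.mul
          (continuous_subtype_val.comp AddCircle.continuous_toCircle)))))
    · exact integrable_const m
  rw [hsub, integral_comp_re_mul_toCircle_eq_two_mul hk₀c, abs_mul, abs_two]
  linarith [hosc k₀ K ‖c‖ hk₀c hk₀B hK (by simpa using hKB) hc]

end Equidistribution

section OrbitAverages

theorem abs_integral_sub_integral_le {α : Type*} [MeasurableSpace α] {μ : Measure α}
    [IsProbabilityMeasure μ] {f g : α → ℝ} {ε : ℝ} (hf : Integrable f μ) (hg : Integrable g μ)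
    (h : ∀ x, |f x - g x| ≤ ε) : |(∫ x, f x ∂μ) - ∫ x, g x ∂μ| ≤ ε := by
  rw [← integral_sub hf hg]
  simpa using norm_integral_le_of_norm_le_const (μ := μ) (f := fun x => f x - g x) (.of_forall h)

section Basic

variable {X : Type*} [TopologicalSpace X]

theorem continuous_orbit (φ : Flow 𝕋 X) (F : C(X, ℝ)) (x : X) : Continuous fun t => F (φ t x) := by
  fun_prop

/-- The average of an observable along the orbits of a circle action. -/
def orbitAvg (φ : Flow 𝕋 X) (F : C(X, ℝ)) : C(X, ℝ) where
  toFun x := ∫ t, F (φ t x)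
  continuous_toFun := by
    have horbit : Continuous fun x => (⟨fun t => F (φ t x), continuous_orbit φ F x⟩ : C(𝕋, ℝ)) :=
      ContinuousMap.continuous_of_continuous_uncurry _ (by
        have := φ.continuous continuous_snd continuous_fst
        exact F.continuous.comp this)
    have hint : LipschitzWith 1 fun k : C(𝕋, ℝ) => ∫ t, k t :=
      LipschitzWith.mk_one fun k l =>
        abs_integral_sub_integral_le (integrable_of_continuous k.continuous)
          (integrable_of_continuous l.continuous) fun t =>
          (Real.dist_eq _ _).symm.trans_le (ContinuousMap.dist_apply_le_dist t)
    exact hint.continuous.comp horbit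

theorem orbitAvg_apply (φ : Flow 𝕋 X) (F : C(X, ℝ)) (x : X) :
    orbitAvg φ F x = ∫ t, F (φ t x) := rfl

theorem orbitAvg_flow_apply (φ : Flow 𝕋 X) (F : C(X, ℝ)) (s : 𝕋) (x : X) :
    orbitAvg φ F (φ s x) = orbitAvg φ F x := by
  simp only [orbitAvg_apply, ← φ.map_add]
  exact integral_add_right_eq_self (fun t => F (φ t x)) s

theorem orbitAvg_comp_of_commute {φ : Flow 𝕋 X} {f : X → X} {F : C(X, ℝ)}
    (hf : ∀ t x, φ t (f x) = f (φ t x)) (hF : ∀ x, F (f x) = F x) (x : X) :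
    orbitAvg φ F (f x) = orbitAvg φ F x := by
  simp only [orbitAvg_apply, hf, hF]

theorem abs_orbitAvg_sub_orbitAvg_le (φ : Flow 𝕋 X) {F G : C(X, ℝ)} {x y : X} {ε : ℝ}
    (h : ∀ t, |F (φ t x) - G (φ t y)| ≤ ε) : |orbitAvg φ F x - orbitAvg φ G y| ≤ ε :=
  abs_integral_sub_integral_le (integrable_of_continuous (continuous_orbit φ F x))
    (integrable_of_continuous (continuous_orbit φ G y)) h

theorem orbitAvg_le (φ : Flow 𝕋 X) {F : C(X, ℝ)} {m : ℝ} {x : X} (h : ∀ t, F (φ t x) ≤ m) :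
    orbitAvg φ F x ≤ m := by
  simpa [orbitAvg_apply] using integral_mono (μ := volume)
    (integrable_of_continuous (continuous_orbit φ F x)) (integrable_const m) h

theorem orbitAvg_lt (φ : Flow 𝕋 X) {F : C(X, ℝ)} {m : ℝ} {x : X} (h : ∀ t, F (φ t x) ≤ m) {s : 𝕋}
    (hs : F (φ s x) < m) : orbitAvg φ F x < m := by
  have hint := integrable_of_continuous (μ := volume) (continuous_orbit φ F x)
  have hpos : 0 < ∫ t, m - F (φ t x) :=
    integral_pos_of_integrable_nonneg_nonzero (continuous_const.sub (continuous_orbit φ F x))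
      ((integrable_const m).sub hint) (fun t => sub_nonneg.2 (h t)) (sub_pos.2 hs).ne'
  rw [integral_sub (integrable_const m) hint, integral_const, probReal_univ, one_smul] at hpos
  exact sub_pos.1 hpos

/-- Successive averages of an observable along several circle actions. -/
def avgList {ι : Type*} (T : ι → Flow 𝕋 X) (L : List ι) (F : C(X, ℝ)) : C(X, ℝ) :=
  L.foldr (fun u G => orbitAvg (T u) G) F

theorem avgList_append {ι : Type*} (T : ι → Flow 𝕋 X) (L L' : List ι) (F : C(X, ℝ)) :
    avgList T (L ++ L') F = avgList T L (avgList T L' F) := List.foldr_append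

theorem avgList_comp_of_commute {ι : Type*} {T : ι → Flow 𝕋 X} {f : X → X} {F : C(X, ℝ)}
    (hf : ∀ u t x, T u t (f x) = f (T u t x)) (hF : ∀ x, F (f x) = F x) (L : List ι) (x : X) :
    avgList T L F (f x) = avgList T L F x := by
  induction L generalizing x with
  | nil => exact hF x
  | cons u L ih => exact orbitAvg_comp_of_commute (hf u) ih x

theorem avgList_le {ι : Type*} (T : ι → Flow 𝕋 X) (L : List ι) {F : C(X, ℝ)} {m : ℝ}
    (h : ∀ x, F x ≤ m) (x : X) : avgList T L F x ≤ m := by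
  induction L generalizing x with
  | nil => exact h x
  | cons u L ih => exact orbitAvg_le (T u) fun t => ih _

theorem avgList_lt_of_lt {ι : Type*} (T : ι → Flow 𝕋 X) {L : List ι} {F : C(X, ℝ)} {m : ℝ}
    (h : ∀ x, F x ≤ m) {x : X} (hx : F x < m) : avgList T L F x < m := by
  induction L with
  | nil => exact hx
  | cons u L ih =>
    exact orbitAvg_lt (T u) (s := 0) (fun t => avgList_le T L h _) (by rwa [(T u).map_zero_apply])

theorem avgList_lt_of_mem {ι : Type*} (T : ι → Flow 𝕋 X) {L : List ι} {F : C(X, ℝ)} {m : ℝ}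
    (h : ∀ x, F x ≤ m) {u : ι} (hu : u ∈ L) {s : 𝕋} {x : X} (hs : F (T u s x) < m) :
    avgList T L F x < m := by
  induction L with
  | nil => simp at hu
  | cons v L ih =>
    obtain rfl | hu := List.mem_cons.1 hu
    · exact orbitAvg_lt (T u) (fun t => avgList_le T L h _) (avgList_lt_of_lt T h hs)
    · exact orbitAvg_lt (T v) (s := 0) (fun t => avgList_le T L h _)
        (by rw [(T v).map_zero_apply]; exact ih hu)

theorem exists_avgList_lt [CompactSpace X] {ι : Type*} (T : ι → Flow 𝕋 X) {F : C(X, ℝ)} {m : ℝ}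
    (hm : ∀ x, F x ≤ m) (h : ∀ x, ∃ u s, F (T u s x) < m) : ∃ L, ∀ x, avgList T L F x < m := by
  have hopen : ∀ u, IsOpen (⋃ s, {x | F (T u s x) < m}) := fun u =>
    isOpen_iUnion fun s => isOpen_lt (by fun_prop) continuous_const
  obtain ⟨L, hL⟩ := isCompact_univ.elim_finite_subcover _ hopen fun x _ => by
    simpa using h x
  refine ⟨L.toList, fun x => ?_⟩
  obtain ⟨u, hu, s, hs⟩ : ∃ u ∈ L, ∃ s, F (T u s x) < m := by simpa using hL (Set.mem_univ x)
  exact avgList_lt_of_mem T hm (Finset.mem_toList.2 hu) hs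

end Basic

theorem abs_avgList_sub_le_of_isometry {X : Type*} [PseudoMetricSpace X] {ι : Type*}
    {T : ι → Flow 𝕋 X} (hT : ∀ u s, Isometry (T u s)) {F : C(X, ℝ)} {δ ε : ℝ}
    (hF : ∀ x y, dist x y < δ → |F x - F y| ≤ ε) (L : List ι) {x y : X} (hxy : dist x y < δ) :
    |avgList T L F x - avgList T L F y| ≤ ε := by
  induction L generalizing x y with
  | nil => exact hF x y hxy
  | cons u L ih =>
    exact abs_orbitAvg_sub_orbitAvg_le (T u) fun t => ih (by rwa [(hT u t).dist_eq])

section Compact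

variable {X : Type*} [TopologicalSpace X] [CompactSpace X]

theorem lipschitzWith_orbitAvg (φ : Flow 𝕋 X) : LipschitzWith 1 (orbitAvg φ) :=
  LipschitzWith.mk_one fun _ _ => (ContinuousMap.dist_le dist_nonneg).2 fun _ =>
    abs_orbitAvg_sub_orbitAvg_le φ fun _ =>
      (Real.dist_eq _ _).symm.trans_le (ContinuousMap.dist_apply_le_dist _)

theorem lipschitzWith_avgList {ι : Type*} (T : ι → Flow 𝕋 X) (L : List ι) :
    LipschitzWith 1 (avgList T L) := by
  induction L with
  | nil => exact LipschitzWith.id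
  | cons u L ih => exact mul_one (1 : NNReal) ▸ (lipschitzWith_orbitAvg (T u)).comp ih

theorem norm_avgList_le {ι : Type*} (T : ι → Flow 𝕋 X) (L : List ι) (F : C(X, ℝ)) :
    ‖avgList T L F‖ ≤ ‖F‖ := by
  have h0 : avgList T L 0 = 0 := by
    induction L with
    | nil => rfl
    | cons u L ih =>
      ext x
      change ∫ t, avgList T L 0 (T u t x) = 0
      simp [ih]
  simpa [h0] using (lipschitzWith_avgList T L).dist_le_mul F 0

theorem avgList_mem_closure_range {ι : Type*} (T : ι → Flow 𝕋 X) (L : List ι) {F G : C(X, ℝ)}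
    (hG : G ∈ closure (Set.range fun L => avgList T L F)) :
    avgList T L G ∈ closure (Set.range fun L => avgList T L F) := by
  refine map_mem_closure (lipschitzWith_avgList T L).continuous hG ?_
  rintro _ ⟨L', rfl⟩
  exact ⟨L ++ L', avgList_append T L L' F⟩

end Compact

theorem isCompact_closure_range_avgList {X : Type*} [PseudoMetricSpace X] [CompactSpace X]
    {ι : Type*} {T : ι → Flow 𝕋 X} (hT : ∀ u s, Isometry (T u s)) (F : C(X, ℝ)) :
    IsCompact (closure (Set.range fun L => avgList T L F)) := by
  set e := (ContinuousMap.isometryEquivBoundedOfCompact X ℝ).toHomeomorph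
  rw [← e.isCompact_image, e.image_closure]
  refine BoundedContinuousFunction.arzela_ascoli _ (isCompact_closedBall 0 ‖F‖) _ ?_ ?_
  · rintro _ x ⟨_, ⟨L, rfl⟩, rfl⟩
    rw [mem_closedBall_zero_iff]
    exact ((avgList T L F).norm_coe_le_norm x).trans (norm_avgList_le T L F)
  · refine fun x₀ => Metric.equicontinuousAt_iff.2 fun ε hε => ?_
    obtain ⟨δ, hδ, hFδ⟩ := Metric.uniformContinuous_iff.1
      (CompactSpace.uniformContinuous_of_continuous F.continuous) (ε / 2) (half_pos hε)
    refine ⟨δ, hδ, ?_⟩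
    rintro x hx ⟨_, _, ⟨L, rfl⟩, rfl⟩
    refine lt_of_le_of_lt ?_ (half_lt_self hε)
    exact abs_avgList_sub_le_of_isometry hT (fun a b hab => (hFδ hab).le) L (by rwa [dist_comm])

-- An observable of minimal maximum in the compact closure of the iterated averages is constant,
-- because some further averaging would lower the maximum of a nonconstant one.
theorem exists_avgList_near_const {X : Type*} [PseudoMetricSpace X] [CompactSpace X] {ι : Type*}
    (φ : Flow 𝕋 X) {T : ι → Flow 𝕋 X} (hcomm : ∀ u s t x, T u s (φ t x) = φ t (T u s x))
    (hiso : ∀ u s, Isometry (T u s)) (htrans : ∀ x y, ∃ u s t, T u s x = φ t y) {F : C(X, ℝ)}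
    (hF : ∀ t x, F (φ t x) = F x) {ε : ℝ} (hε : 0 < ε) :
    ∃ (L : List ι) (c : ℝ), ∀ x, |avgList T L F x - c| ≤ ε := by
  set S : Set C(X, ℝ) := Set.range fun L => avgList T L F
  have hbound : closure S ⊆ {G | ‖G‖ ≤ ‖F‖} := by
    refine closure_minimal ?_ (isClosed_le continuous_norm continuous_const)
    rintro _ ⟨L, rfl⟩
    exact norm_avgList_le T L F
  have hinv : closure S ⊆ {G | ∀ t x, G (φ t x) = G x} := by
    refine closure_minimal ?_ ?_
    · rintro _ ⟨L, rfl⟩ t x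
      exact avgList_comp_of_commute (fun u s y => hcomm u s t y) (hF t) L x
    · simp only [Set.ofPred_forall]
      exact isClosed_iInter fun t => isClosed_iInter fun x =>
        isClosed_eq (continuous_eval_const _) (continuous_eval_const _)
  obtain ⟨G, hG, hGmin⟩ := (isCompact_closure_range_avgList hiso F).exists_isMinOn
    (f := fun G : C(X, ℝ) => ‖G + ContinuousMap.const X ‖F‖‖) ⟨F, subset_closure ⟨[], rfl⟩⟩
    (by fun_prop)
  have hnonneg : ∀ H ∈ closure S, ∀ x, 0 ≤ H x + ‖F‖ := fun H hH x => by
    linarith [neg_le_of_abs_le ((H.norm_coe_le_norm x).trans (hbound hH))]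
  set m := ‖G + ContinuousMap.const X ‖F‖‖ - ‖F‖
  have hGm : ∀ x, G x ≤ m := fun x => le_sub_iff_add_le.2
    ((le_abs_self _).trans ((G + ContinuousMap.const X ‖F‖).norm_coe_le_norm x))
  have hconst : ∀ y, G y = m := by
    refine fun y => (hGm y).antisymm (le_of_not_gt fun hy => ?_)
    obtain ⟨L, hL⟩ := exists_avgList_lt T hGm fun x => by
      obtain ⟨u, s, t, hxy⟩ := htrans x y
      exact ⟨u, s, by rwa [hxy, hinv hG]⟩
    have hLG := avgList_mem_closure_range T L hG
    refine not_lt_of_ge (hGmin hLG) ((ContinuousMap.norm_lt_iff _ ?_).2 fun x => ?_)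
    · linarith [hnonneg G hG y]
    · rw [ContinuousMap.add_apply, ContinuousMap.const_apply,
        Real.norm_of_nonneg (hnonneg _ hLG x)]
      linarith [hL x]
  obtain ⟨_, ⟨L, rfl⟩, hL⟩ := Metric.mem_closure_iff.1 hG ε hε
  refine ⟨L, m, fun x => ?_⟩
  rw [← hconst x, ← Real.dist_eq, dist_comm]
  exact (ContinuousMap.dist_apply_le_dist x).trans hL.le

end OrbitAverages

section Shear

theorem exists_nsmul_eq_of_pos {q : ℕ} (hq : 0 < q) (σ : 𝕋) :
    ∃ s ∈ Set.Icc (0 : ℝ) (1 / q), q • (s : 𝕋) = σ := by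
  obtain ⟨x, hx, rfl⟩ : σ ∈ ((↑) : ℝ → 𝕋) '' Set.Ico 0 (0 + 1) :=
    AddCircle.coe_image_Ico_eq (1 : ℝ) 0 ▸ Set.mem_univ σ
  rw [zero_add] at hx
  refine ⟨x / q, ⟨by have := hx.1; positivity, by have := hx.2.le; gcongr⟩, ?_⟩
  rw [← AddCircle.coe_nsmul, nsmul_eq_mul, mul_div_cancel₀ x (by positivity)]

theorem eventually_forall_abs_flow_sub_le {X : Type*} [TopologicalSpace X] [CompactSpace X]
    (φ : Flow 𝕋 X) (F : C(X, ℝ)) {ε : ℝ} (hε : 0 < ε) :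
    ∀ᶠ r : ℕ in atTop, ∀ s ∈ Set.Icc (0 : ℝ) (1 / r), ∀ x, |F (φ s x) - F x| ≤ ε := by
  have hnear : ∀ᶠ s : ℝ in 𝓝 0, ∀ x ∈ Set.univ, |F (φ (s : 𝕋) x) - F x| < ε := by
    refine isCompact_univ.eventually_forall_of_forall_eventually fun x _ => ?_
    have hc : Continuous fun p : ℝ × X => |F (φ p.1 p.2) - F p.2| := by
      have := φ.continuous ((AddCircle.continuous_mk' 1).comp continuous_fst) continuous_snd
      exact ((F.continuous.comp this).sub (F.continuous.comp continuous_snd)).abs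
    refine hc.continuousAt.eventually_lt_const ?_
    simpa using hε
  obtain ⟨δ, hδ, hFδ⟩ := Metric.eventually_nhds_iff.1 hnear
  filter_upwards [tendsto_one_div_atTop_nhds_zero_nat.eventually_lt_const hδ] with r hr s hs x
  refine (hFδ ?_ x trivial).le
  rw [Real.dist_eq, sub_zero, abs_of_nonneg hs.1]
  exact hs.2.trans_lt hr

-- A translation of the fast variable `q • t` is induced by a small one of the slow variable `t`, so
-- the left integral hardly changes under it and may be averaged over all these translations.
theorem abs_integral_nsmul_sub_integral_integral_le {g : 𝕋 × 𝕋 → ℝ} (hg : Continuous g) (q : ℕ)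
    {ε : ℝ} (h : ∀ σ, ∃ τ, q • τ = σ ∧ ∀ s t, |g (s, t + τ) - g (s, t)| ≤ ε) :
    |(∫ t, g (q • t, t)) - ∫ s, ∫ t, g (s, t)| ≤ ε := by
  have hdiag : ∀ σ, |(∫ t, g (q • t, t)) - ∫ t, g (q • t + σ, t)| ≤ ε := by
    intro σ
    obtain ⟨τ, rfl, hτ⟩ := h σ
    rw [← integral_add_right_eq_self (fun t => g (q • t, t)) τ]
    simp only [nsmul_add]
    exact abs_integral_sub_integral_le (integrable_of_continuous (by fun_prop))
      (integrable_of_continuous (by fun_prop)) fun t => hτ _ t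
  have hswap : ∫ σ, ∫ t, g (q • t + σ, t) = ∫ s, ∫ t, g (s, t) := by
    rw [integral_integral_swap (f := fun σ t => g (q • t + σ, t))
        (integrable_of_continuous (by fun_prop)),
      integral_integral_swap (f := fun s t => g (s, t)) (integrable_of_continuous (by fun_prop))]
    exact integral_congr_ae (.of_forall fun t =>
      integral_add_left_eq_self (fun s => g (s, t)) (q • t))
  have hmean := abs_integral_sub_integral_le (μ := (volume : Measure 𝕋)) (ε := ε)
    (f := fun _ => ∫ t, g (q • t, t)) (g := fun σ => ∫ t, g (q • t + σ, t)) (integrable_const _)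
    (Integrable.integral_prod_left (f := fun p : 𝕋 × 𝕋 => g (q • p.2 + p.1, p.2))
      (integrable_of_continuous (by fun_prop))) hdiag
  rwa [integral_const, probReal_univ, one_smul, hswap] at hmean

theorem exists_pos_forall_norm_lt_abs_le {Y E : Type*} [TopologicalSpace Y] [CompactSpace Y]
    [NormedAddCommGroup E] {w : Y → E} {u : Y → ℝ} (hw : Continuous w) (hu : Continuous u)
    (h : ∀ y, w y = 0 → u y = 0) {ε : ℝ} (hε : 0 < ε) : ∃ c > 0, ∀ y, ‖w y‖ < c → |u y| ≤ ε := by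
  have hK : IsCompact {y | ε ≤ |u y|} := (isClosed_le continuous_const hu.abs).isCompact
  obtain ⟨c, hc, H⟩ := hK.exists_forall_le' (a := (0 : ℝ)) hw.norm.continuousOn fun y hy =>
    norm_pos_iff.2 fun hwy => by simp_all [not_le.2 hε]
  exact ⟨c, hc, fun y hy => le_of_not_ge fun hcon => not_lt.2 (H y hcon) hy⟩

section

variable {X : Type*} [TopologicalSpace X] [CompactSpace X] {φ T : Flow 𝕋 X}

theorem exists_pos_forall_norm_lt_abs_integral_sub_le {w : C(X, ℂ)} {G : C(X, ℝ)}
    (h0 : ∀ s x, w x = 0 → G (T s x) = G x) {ε : ℝ} (hε : 0 < ε) :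
    ∃ c > 0, ∀ x, ‖w x‖ < c → ∀ Θ : 𝕋 → 𝕋, Continuous Θ →
      |(∫ s, G (T (Θ s) x)) - orbitAvg T G x| ≤ ε := by
  have hu : Continuous fun p : 𝕋 × X => G (T p.1 p.2) - G p.2 :=
    (G.continuous.comp (T.continuous continuous_fst continuous_snd)).sub
      (G.continuous.comp continuous_snd)
  obtain ⟨c, hc, H⟩ := exists_pos_forall_norm_lt_abs_le (w := fun p : 𝕋 × X => w p.2)
    (by fun_prop) hu (fun p hp => sub_eq_zero.2 (h0 p.1 p.2 hp)) (half_pos hε)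
  refine ⟨c, hc, fun x hx Θ hΘ => ?_⟩
  refine abs_integral_sub_integral_le
    (integrable_of_continuous ((continuous_orbit T G x).comp hΘ))
    (integrable_of_continuous (continuous_orbit T G x)) fun s => ?_
  have h₁ := abs_le.1 (H (Θ s, x) hx)
  have h₂ := abs_le.1 (H (s, x) hx)
  exact abs_le.2 ⟨by linarith, by linarith⟩

-- Where `c ≤ ‖w x‖` the time of the shear oscillates fast and equidistributes; where `‖w x‖ < c`
-- the flow `T` almost moves `x` along its `φ`-orbit, so that averaging over `T` changes nothing.
theorem exists_shear_avg (hcomm : ∀ s t x, T s (φ t x) = φ t (T s x))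
    {w : C(X, ℂ)} (hφ : ∀ t x, w (φ t x) = toCircle t * w x)
    (h0 : ∀ s x, w x = 0 → T s x = φ s x) (F : C(X, ℝ)) {ε : ℝ} (hε : 0 < ε) {N : ℕ}
    (hN : 0 < N) :
    ∃ (q : ℕ) (M : ℝ), N ∣ q ∧ ∀ x,
      |(∫ t, F (T (M * (w (φ t x) ^ q).re : ℝ) (φ t x))) - orbitAvg T (orbitAvg φ F) x| ≤ ε := by
  set G := orbitAvg φ F with hG
  obtain ⟨c, hc, hcw⟩ := exists_pos_forall_norm_lt_abs_integral_sub_le (T := T) (w := w) (G := G)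
    (fun s x hx => by rw [h0 s x hx, orbitAvg_flow_apply]) (half_pos hε)
  obtain ⟨R₀, hR₀, hR⟩ := exists_forall_abs_integral_re_mul_toCircle_sub_le ‖G‖ (half_pos hε)
  obtain ⟨q, hFq, hq, hNq⟩ : ∃ q : ℕ, (∀ s ∈ Set.Icc (0 : ℝ) (1 / q), ∀ x,
      |F (φ s x) - F x| ≤ ε / 2) ∧ 0 < q ∧ N ∣ q := by
    have hmul := tendsto_id.atTop_mul_const' hN
    obtain ⟨m, h₁, h₂⟩ := ((hmul.eventually
      (eventually_forall_abs_flow_sub_le φ F (half_pos hε))).and (eventually_gt_atTop 0)).exists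
    exact ⟨m * N, h₁, Nat.mul_pos h₂ hN, Dvd.intro_left m rfl⟩
  refine ⟨q, R₀ / c ^ q, hNq, fun x => ?_⟩
  set b : ℂ := (R₀ / c ^ q : ℝ) * w x ^ q with hb
  set Θ : 𝕋 → 𝕋 := fun s => ((b * toCircle s).re : ℝ) with hΘ
  have hΘc : Continuous Θ := (AddCircle.continuous_mk' 1).comp (by fun_prop)
  have hΘq : ∀ t, (((R₀ / c ^ q) * (w (φ t x) ^ q).re : ℝ) : 𝕋) = Θ (q • t) := fun t => by
    simp only [hΘ, hb, hφ, AddCircle.toCircle_nsmul, Circle.coe_pow, ← Complex.re_ofReal_mul]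
    ring_nf
  have hfast : |(∫ t, F (T (Θ (q • t)) (φ t x))) - ∫ s, G (T (Θ s) x)| ≤ ε / 2 := by
    simp only [hG, orbitAvg_apply, ← hcomm]
    refine abs_integral_nsmul_sub_integral_integral_le (g := fun p => F (T (Θ p.1) (φ p.2 x)))
      (F.continuous.comp (T.continuous (by fun_prop) (by fun_prop))) q fun σ => ?_
    obtain ⟨τ, hτ, hσ⟩ := exists_nsmul_eq_of_pos hq σ
    refine ⟨τ, hσ, fun s t => ?_⟩
    rw [add_comm, φ.map_add, hcomm]
    exact hFq τ hτ _
  have hslow : |(∫ s, G (T (Θ s) x)) - orbitAvg T G x| ≤ ε / 2 := by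
    obtain hlt | hge := lt_or_ge ‖w x‖ c
    · exact hcw x hlt Θ hΘc
    · refine hR (fun s => G (T s x)) b (continuous_orbit T G x) (fun s => G.norm_coe_le_norm _) ?_
      rw [hb, norm_mul, norm_pow, Complex.norm_real, Real.norm_of_nonneg (by positivity),
        div_mul_eq_mul_div, le_div_iff₀ (by positivity)]
      gcongr
  simp only [hΘq]
  linarith [abs_sub_le (∫ t, F (T (Θ (q • t)) (φ t x))) (∫ s, G (T (Θ s) x)) (orbitAvg T G x)]

end

end Shear

section MeasurePreserving

theorem measurePreserving_of_tendsto {X Y : Type*} [MeasurableSpace X] [MeasurableSpace Y]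
    [PseudoMetricSpace Y] [BorelSpace Y] {μ : Measure X} {ν : Measure Y} [IsFiniteMeasure μ]
    [IsFiniteMeasure ν] {g : ℕ → X → Y} {f : X → Y} (hg : ∀ k, MeasurePreserving (g k) μ ν)
    (h : ∀ x, Tendsto (fun k => g k x) atTop (𝓝 (f x))) : MeasurePreserving f μ ν := by
  have hf : Measurable f :=
    measurable_of_tendsto_metrizable (fun k => (hg k).measurable) (tendsto_pi_nhds.2 h)
  have : IsFiniteMeasure (μ.map f) := Measure.isFiniteMeasure_map μ f
  refine ⟨hf, ext_of_forall_integral_eq_of_IsFiniteMeasure fun F => ?_⟩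
  have hFg : ∀ k, ∫ x, F (g k x) ∂μ = ∫ y, F y ∂ν := fun k => by
    rw [← (hg k).map_eq, integral_map (hg k).aemeasurable F.continuous.aestronglyMeasurable]
  have hlim : Tendsto (fun k => ∫ x, F (g k x) ∂μ) atTop (𝓝 (∫ x, F (f x) ∂μ)) :=
    tendsto_integral_of_dominated_convergence (fun _ => ‖F‖)
      (fun k => (F.continuous.measurable.comp (hg k).measurable).aestronglyMeasurable)
      (integrable_const _) (fun k => .of_forall fun x => F.norm_coe_le_norm _)
      (.of_forall fun x => (F.continuous.tendsto _).comp (h x))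
  rw [integral_map hf.aemeasurable F.continuous.aestronglyMeasurable]
  exact tendsto_nhds_unique hlim (by simp only [hFg, tendsto_const_nhds])

theorem measurePreserving_flow_of_invariant {X : Type*} [TopologicalSpace X]
    [SecondCountableTopology X] [MeasurableSpace X] [BorelSpace X] {μ : Measure X} [SFinite μ]
    {T : Flow 𝕋 X} (hT : ∀ s, MeasurePreserving (T s) μ μ) {ψ : X → 𝕋} (hψ : Measurable ψ)
    (hψT : ∀ s x, ψ (T s x) = ψ x) : MeasurePreserving (fun x => T (ψ x) x) μ μ := by
  have hTm : ∀ {Y : Type _} [MeasurableSpace Y] {a : Y → 𝕋} {b : Y → X}, Measurable a →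
      Measurable b → Measurable fun y => T (a y) (b y) := fun ha hb =>
    (T.continuous continuous_fst continuous_snd).measurable.comp (ha.prodMk hb)
  refine ⟨hTm hψ measurable_id', Measure.ext_of_lintegral _ fun F hF => ?_⟩
  rw [lintegral_map hF (hTm hψ measurable_id')]
  have hshift : ∀ s, ∫⁻ x, F (T (ψ x + s) x) ∂μ = ∫⁻ x, F (T (ψ x) x) ∂μ := fun s => by
    simpa only [Function.comp_def, hψT, ← T.map_add] using
      (hT s).lintegral_comp (hF.comp (hTm hψ measurable_id'))
  have hleft : Measurable fun p : 𝕋 × X => F (T (ψ p.2 + p.1) p.2) :=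
    hF.comp (hTm ((hψ.comp measurable_snd).add measurable_fst) measurable_snd)
  have hright : Measurable fun p : 𝕋 × X => F (T p.1 p.2) :=
    hF.comp (hTm measurable_fst measurable_snd)
  calc ∫⁻ x, F (T (ψ x) x) ∂μ = ∫⁻ s : 𝕋, ∫⁻ x, F (T (ψ x + s) x) ∂μ := by
        simp only [hshift, lintegral_const, measure_univ, mul_one]
    _ = ∫⁻ x, (∫⁻ s : 𝕋, F (T (ψ x + s) x)) ∂μ :=
        lintegral_lintegral_swap (f := fun s x => F (T (ψ x + s) x)) hleft.aemeasurable
    _ = ∫⁻ x, (∫⁻ s : 𝕋, F (T s x)) ∂μ :=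
        lintegral_congr fun x => lintegral_add_left_eq_self (fun s => F (T s x)) (ψ x)
    _ = ∫⁻ s : 𝕋, ∫⁻ x, F (T s x) ∂μ :=
        (lintegral_lintegral_swap (f := fun s x => F (T s x)) hright.aemeasurable).symm
    _ = ∫⁻ x, F x ∂μ := by
        simp only [(hT _).lintegral_comp hF, lintegral_const, measure_univ, mul_one]

open scoped Pointwise in
theorem measurePreserving_toSphere {E : Type*} [NormedAddCommGroup E] [InnerProductSpace ℝ E]
    [FiniteDimensional ℝ E] [MeasurableSpace E] [BorelSpace E] (A : E ≃ₗᵢ[ℝ] E)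
    {g : Metric.sphere (0 : E) 1 → Metric.sphere (0 : E) 1} (hg : ∀ x, (g x : E) = A x) :
    MeasurePreserving g (volume : Measure E).toSphere (volume : Measure E).toSphere := by
  have hgm : Measurable g := by
    refine (continuous_induced_rng.2 ?_).measurable
    exact (A.continuous.comp continuous_subtype_val).congr fun x => (hg x).symm
  have hcone (s : Set (Metric.sphere (0 : E) 1)) :
      A ⁻¹' (Set.Ioo (0 : ℝ) 1 • ((↑) '' s : Set E)) =
        Set.Ioo (0 : ℝ) 1 • ((↑) '' (g ⁻¹' s) : Set E) := by
    ext x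
    simp only [Set.mem_smul, Set.mem_image, Set.mem_preimage]
    constructor
    · rintro ⟨r, hr, _, ⟨y, hy, rfl⟩, hx⟩
      have hgy : g ⟨A.symm y, by simp⟩ = y := Subtype.ext (by simp [hg])
      exact ⟨r, hr, _, ⟨⟨A.symm y, by simp⟩, by rwa [hgy], rfl⟩, A.injective (by simp [hx])⟩
    · rintro ⟨r, hr, _, ⟨y, hy, rfl⟩, rfl⟩
      exact ⟨r, hr, _, ⟨g y, hy, rfl⟩, by simp [hg]⟩
  refine ⟨hgm, Measure.ext fun s hs => ?_⟩
  have hA : volume (A ⁻¹' (Set.Ioo (0 : ℝ) 1 • ((↑) '' s : Set E))) =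
      volume (Set.Ioo (0 : ℝ) 1 • ((↑) '' s : Set E)) :=
    A.measurePreserving.measure_preimage_equiv (f := A.toMeasurableEquiv) _
  rw [Measure.map_apply hgm hs, Measure.toSphere_apply' _ hs, Measure.toSphere_apply' _ (hgm hs),
    ← hcone, hA]

end MeasurePreserving

section Linear

variable {𝕜 : Type} [RCLike 𝕜] {n : ℕ}

/-- The bilinear form `∑ i, x i * y i`, which is not conjugated in the complex case and hence is
holomorphic in both variables. -/
def dotForm : EvenSpace 𝕜 n →ₗ[𝕜] EvenSpace 𝕜 n →ₗ[𝕜] 𝕜 :=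
  LinearMap.mk₂ 𝕜 (fun x y => ∑ i, x i * y i)
    (fun x y z => by simp [add_mul, Finset.sum_add_distrib])
    (fun c x y => by simp [Finset.mul_sum, mul_assoc])
    (fun x y z => by simp [mul_add, Finset.sum_add_distrib])
    (fun c x y => by simp [Finset.mul_sum, mul_left_comm])

/-- The rotation `J` by a quarter turn in all the coordinate planes. -/
def quarterTurn (𝕜 : Type) [RCLike 𝕜] (n : ℕ) : Module.End 𝕜 (EvenSpace 𝕜 n) where
  toFun x := WithLp.toLp 2 fun i => if i.2 = 0 then x (i.1, 1) else -x (i.1, 0)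
  map_add' y z := by
    ext ⟨j, k⟩
    fin_cases k <;> simp [add_comm]
  map_smul' c y := by
    ext ⟨j, k⟩
    fin_cases k <;> simp

theorem dotForm_apply (x y : EvenSpace 𝕜 n) : dotForm x y = ∑ i, x i * y i := rfl

theorem quarterTurn_apply (x : EvenSpace 𝕜 n) (i : Fin n × Fin 2) :
    quarterTurn 𝕜 n x i = if i.2 = 0 then x (i.1, 1) else -x (i.1, 0) := rfl

theorem dotForm_comm (x y : EvenSpace 𝕜 n) : dotForm x y = dotForm y x := by
  simp only [dotForm_apply, mul_comm]

theorem quarterTurn_quarterTurn (x : EvenSpace 𝕜 n) :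
    quarterTurn 𝕜 n (quarterTurn 𝕜 n x) = -x := by
  ext ⟨j, k⟩
  fin_cases k <;> simp [quarterTurn_apply]

theorem dotForm_quarterTurn_left (x y : EvenSpace 𝕜 n) :
    dotForm (quarterTurn 𝕜 n x) y = -dotForm x (quarterTurn 𝕜 n y) := by
  simp [dotForm_apply, quarterTurn_apply, Fintype.sum_prod_type, ← Finset.sum_neg_distrib]

theorem dotForm_quarterTurn_self (x : EvenSpace 𝕜 n) : dotForm x (quarterTurn 𝕜 n x) = 0 := by
  simp [dotForm_apply, quarterTurn_apply, Fintype.sum_prod_type, mul_comm]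

/-- The linear map `c + s J`. -/
def rotationMap (c s : 𝕜) : Module.End 𝕜 (EvenSpace 𝕜 n) := c • 1 + s • quarterTurn 𝕜 n

theorem rotationMap_apply (c s : 𝕜) (x : EvenSpace 𝕜 n) :
    rotationMap c s x = c • x + s • quarterTurn 𝕜 n x := rfl

theorem rotationMap_one_zero : rotationMap (1 : 𝕜) 0 = (1 : Module.End 𝕜 (EvenSpace 𝕜 n)) := by
  simp [rotationMap]

theorem rotationMap_mul_rotationMap (c s c' s' : 𝕜) :
    (rotationMap c s * rotationMap c' s' : Module.End 𝕜 (EvenSpace 𝕜 n)) =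
      rotationMap (c * c' - s * s') (c * s' + s * c') := by
  ext1 x
  simp only [Module.End.mul_apply, rotationMap_apply, map_add, map_smul, quarterTurn_quarterTurn]
  module

theorem planeRotation_eq_rotationMap (t : ℝ) (x : EvenSpace 𝕜 n) :
    planeRotation 𝕜 t x =
      rotationMap (Real.cos (2 * Real.pi * t) : 𝕜) (Real.sin (2 * Real.pi * t) : 𝕜) x := by
  ext ⟨j, k⟩
  fin_cases k
  · simp [planeRotation, rotationMap_apply, quarterTurn_apply, RCLike.real_smul_eq_coe_mul]
  · simp [planeRotation, rotationMap_apply, quarterTurn_apply, RCLike.real_smul_eq_coe_mul]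
    ring

theorem planeRotation_zero (x : EvenSpace 𝕜 n) : planeRotation 𝕜 0 x = x := by
  simp [planeRotation_eq_rotationMap, rotationMap_one_zero]

theorem planeRotation_add (t t' : ℝ) (x : EvenSpace 𝕜 n) :
    planeRotation 𝕜 (t + t') x = planeRotation 𝕜 t (planeRotation 𝕜 t' x) := by
  simp only [planeRotation_eq_rotationMap, ← Module.End.mul_apply, rotationMap_mul_rotationMap]
  rw [mul_add, Real.cos_add, Real.sin_add, add_comm (Real.sin _ * _)]
  norm_cast

theorem dotForm_rotationMap (c s : 𝕜) (u x : EvenSpace 𝕜 n) :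
    dotForm u (rotationMap c s x) = c * dotForm u x - s * dotForm (quarterTurn 𝕜 n u) x := by
  simp [rotationMap_apply, dotForm_quarterTurn_left]

theorem dotForm_quarterTurn_rotationMap (c s : 𝕜) (u x : EvenSpace 𝕜 n) :
    dotForm (quarterTurn 𝕜 n u) (rotationMap c s x) =
      c * dotForm (quarterTurn 𝕜 n u) x + s * dotForm u x := by
  simp [dotForm_rotationMap, quarterTurn_quarterTurn]

theorem dotForm_rotationMap_self {c s : 𝕜} (h : c ^ 2 + s ^ 2 = 1) (x : EvenSpace 𝕜 n) :
    dotForm (rotationMap c s x) (rotationMap c s x) = dotForm x x := by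
  simp only [rotationMap_apply, map_add, map_smul, LinearMap.add_apply, LinearMap.smul_apply,
    smul_eq_mul, dotForm_quarterTurn_left, quarterTurn_quarterTurn, dotForm_quarterTurn_self,
    map_neg]
  linear_combination dotForm x x * h

/-- The linear maps `P` that are orthogonal projections, for the form `dotForm`, onto a
`J`-invariant subspace. -/
structure IsInvariantProj (P : Module.End 𝕜 (EvenSpace 𝕜 n)) : Prop where
  idem : IsIdempotentElem P
  commute : Commute (quarterTurn 𝕜 n) P
  symm : ∀ x y, dotForm (P x) y = dotForm x (P y)

theorem isInvariantProj_one : IsInvariantProj (1 : Module.End 𝕜 (EvenSpace 𝕜 n)) :=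
  ⟨IsIdempotentElem.one, Commute.one_right _, fun _ _ => rfl⟩

/-- The map that acts as `c + s J` on the range of the projection `P` and fixes its complement. -/
def twist (P : Module.End 𝕜 (EvenSpace 𝕜 n)) (c s : 𝕜) : Module.End 𝕜 (EvenSpace 𝕜 n) :=
  1 + (rotationMap c s - 1) * P

theorem twist_apply (P : Module.End 𝕜 (EvenSpace 𝕜 n)) (c s : 𝕜) (x : EvenSpace 𝕜 n) :
    twist P c s x = x + (rotationMap c s (P x) - P x) := rfl

theorem twist_one (c s : 𝕜) : (twist 1 c s : Module.End 𝕜 (EvenSpace 𝕜 n)) = rotationMap c s := by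
  simp [twist]

theorem twist_one_zero (P : Module.End 𝕜 (EvenSpace 𝕜 n)) : twist P 1 0 = 1 := by
  simp [twist, rotationMap_one_zero]

theorem twist_apply_of_apply_eq_self {P : Module.End 𝕜 (EvenSpace 𝕜 n)} {x : EvenSpace 𝕜 n}
    (hx : P x = x) (c s : 𝕜) : twist P c s x = rotationMap c s x := by
  simp [twist_apply, hx]

namespace IsInvariantProj

variable {P : Module.End 𝕜 (EvenSpace 𝕜 n)}

theorem commute_rotationMap (hP : IsInvariantProj P) (c s : 𝕜) : Commute (rotationMap c s) P :=
  ((Commute.one_left P).smul_left c).add_left (hP.commute.smul_left s)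

theorem twist_mul_twist (hP : IsInvariantProj P) (c s c' s' : 𝕜) :
    twist P c s * twist P c' s' = twist P (c * c' - s * s') (c * s' + s * c') := by
  have hPP : P * P = P := hP.idem
  have hcomm : (rotationMap c' s' - 1) * P = P * (rotationMap c' s' - 1) :=
    (hP.commute_rotationMap c' s').sub_left (Commute.one_left P)
  calc twist P c s * twist P c' s'
      = 1 + (rotationMap c s - 1) * P + (rotationMap c' s' - 1) * P
        + (rotationMap c s - 1) * (P * (rotationMap c' s' - 1)) * P := by
        simp only [twist]; noncomm_ring
    _ = 1 + (rotationMap c s - 1) * P + (rotationMap c' s' - 1) * P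
        + (rotationMap c s - 1) * (rotationMap c' s' - 1) * P := by
        rw [← hcomm, mul_assoc (rotationMap c s - 1), mul_assoc _ P, hPP, mul_assoc]
    _ = twist P (c * c' - s * s') (c * s' + s * c') := by
        rw [twist, ← rotationMap_mul_rotationMap]; noncomm_ring

theorem commute_rotationMap_twist (hP : IsInvariantProj P) (a b c s : 𝕜) :
    Commute (rotationMap a b) (twist P c s) := by
  have hrot : Commute (rotationMap a b) (rotationMap c s : Module.End 𝕜 (EvenSpace 𝕜 n)) := by
    rw [commute_iff_eq, rotationMap_mul_rotationMap, rotationMap_mul_rotationMap]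
    ring_nf
  exact (Commute.one_right _).add_right
    ((hrot.sub_right (Commute.one_right _)).mul_right (hP.commute_rotationMap a b))

theorem dotForm_apply_eq_zero (hP : IsInvariantProj P) {u : EvenSpace 𝕜 n} (hu : P u = 0)
    (x : EvenSpace 𝕜 n) : dotForm u (P x) = 0 := by
  rw [← hP.symm, hu, map_zero, LinearMap.zero_apply]

theorem dotForm_twist (hP : IsInvariantProj P) {u : EvenSpace 𝕜 n} (hu : P u = 0) (c s : 𝕜)
    (x : EvenSpace 𝕜 n) : dotForm u (twist P c s x) = dotForm u x := by
  have hrot : rotationMap c s (P x) = P (rotationMap c s x) :=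
    LinearMap.congr_fun (hP.commute_rotationMap c s) x
  rw [twist_apply, hrot, map_add, map_sub, hP.dotForm_apply_eq_zero hu,
    hP.dotForm_apply_eq_zero hu, sub_zero, add_zero]

theorem dotForm_twist_self (hP : IsInvariantProj P) {c s : 𝕜} (h : c ^ 2 + s ^ 2 = 1)
    (x : EvenSpace 𝕜 n) : dotForm (twist P c s x) (twist P c s x) = dotForm x x := by
  have hPP : P (P x) = P x := LinearMap.congr_fun hP.idem x
  have hrot : rotationMap c s (P x) = P (rotationMap c s x) :=
    LinearMap.congr_fun (hP.commute_rotationMap c s) x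
  have horth : ∀ y, dotForm (x - P x) (P y) = 0 := hP.dotForm_apply_eq_zero (by simp [hPP])
  have hpyth : ∀ y, dotForm (x - P x + P y) (x - P x + P y) =
      dotForm (x - P x) (x - P x) + dotForm (P y) (P y) := fun y => by
    simp only [map_add, LinearMap.add_apply, horth, dotForm_comm (P y) (x - P x)]
    ring
  calc dotForm (twist P c s x) (twist P c s x)
      = dotForm (x - P x) (x - P x) + dotForm (P x) (P x) := by
        rw [show twist P c s x = x - P x + P (rotationMap c s x) by rw [twist_apply, hrot]; abel,
          hpyth, ← hrot, dotForm_rotationMap_self h]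
    _ = dotForm x x := by rw [← hpyth, sub_add_cancel]

end IsInvariantProj

/-- The projection along the plane spanned by a unit vector `u` and its quarter turn. -/
def perpProj (u : EvenSpace 𝕜 n) : Module.End 𝕜 (EvenSpace 𝕜 n) :=
  1 - (dotForm u).smulRight u - (dotForm (quarterTurn 𝕜 n u)).smulRight (quarterTurn 𝕜 n u)

theorem perpProj_apply (u x : EvenSpace 𝕜 n) : perpProj u x =
    x - dotForm u x • u - dotForm (quarterTurn 𝕜 n u) x • quarterTurn 𝕜 n u := rfl

theorem perpProj_quarterTurn (u x : EvenSpace 𝕜 n) :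
    perpProj u (quarterTurn 𝕜 n x) = quarterTurn 𝕜 n (perpProj u x) := by
  have h : dotForm u (quarterTurn 𝕜 n x) = -dotForm (quarterTurn 𝕜 n u) x := by
    rw [dotForm_quarterTurn_left, neg_neg]
  simp only [perpProj_apply, map_sub, map_smul, quarterTurn_quarterTurn,
    dotForm_quarterTurn_left u (quarterTurn 𝕜 n x), h, map_neg, neg_neg]
  module

theorem dotForm_perpProj (u x y : EvenSpace 𝕜 n) :
    dotForm (perpProj u x) y = dotForm x (perpProj u y) := by
  simp only [perpProj_apply, map_sub, map_smul, LinearMap.sub_apply, LinearMap.smul_apply,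
    smul_eq_mul, dotForm_comm x]
  ring

theorem perpProj_self {u : EvenSpace 𝕜 n} (hu : dotForm u u = 1) : perpProj u u = 0 := by
  simp [perpProj_apply, hu, dotForm_comm _ u, dotForm_quarterTurn_self]

theorem perpProj_quarterTurn_self {u : EvenSpace 𝕜 n} (hu : dotForm u u = 1) :
    perpProj u (quarterTurn 𝕜 n u) = 0 := by
  rw [perpProj_quarterTurn, perpProj_self hu, map_zero]

theorem isInvariantProj_perpProj {u : EvenSpace 𝕜 n} (hu : dotForm u u = 1) :
    IsInvariantProj (perpProj u) where
  idem := LinearMap.ext fun x => by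
    change perpProj u (perpProj u x) = perpProj u x
    conv_lhs => rw [perpProj_apply u x]
    simp [perpProj_self hu, perpProj_quarterTurn_self hu]
  commute := LinearMap.ext fun x => (perpProj_quarterTurn u x).symm
  symm := dotForm_perpProj u

theorem dotForm_complexify (x y : EvenSpace ℝ n) :
    dotForm (complexify x) (complexify y) = ((dotForm x y : ℝ) : ℂ) := by
  simp [dotForm_apply, complexify]

theorem quarterTurn_complexify (x : EvenSpace ℝ n) :
    quarterTurn ℂ n (complexify x) = complexify (quarterTurn ℝ n x) := by
  ext i
  simp only [quarterTurn_apply, complexify]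
  split_ifs <;> simp

theorem twist_perpProj_complexify (u x : EvenSpace ℝ n) (c s : ℝ) :
    twist (perpProj (complexify u)) (c : ℂ) (s : ℂ) (complexify x) =
      complexify (twist (perpProj u) c s x) := by
  simp only [twist_apply, rotationMap_apply, perpProj_apply, quarterTurn_complexify,
    dotForm_complexify, map_sub, map_smul]
  ext i
  simp [complexify]

theorem dotForm_eq_inner (x y : EvenSpace ℝ n) : dotForm x y = inner ℝ x y := by
  simp [dotForm_apply, PiLp.inner_apply, mul_comm]

theorem dotForm_self_eq_norm_sq (x : EvenSpace ℝ n) : dotForm x x = ‖x‖ ^ 2 := by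
  rw [dotForm_eq_inner, real_inner_self_eq_norm_sq]

end Linear

section SphereFlow

variable {n : ℕ}

theorem toCircle_re_sq_add_im_sq (t : 𝕋) :
    (toCircle t : ℂ).re ^ 2 + (toCircle t : ℂ).im ^ 2 = 1 := by
  rw [← Complex.normSq_add_mul_I, Complex.re_add_im, Circle.normSq_coe]

theorem coe_toCircle_re (t : ℝ) : (toCircle (t : 𝕋) : ℂ).re = Real.cos (2 * Real.pi * t) := by
  rw [AddCircle.toCircle_apply_mk, Circle.coe_exp, Complex.exp_ofReal_mul_I_re, div_one]

theorem coe_toCircle_im (t : ℝ) : (toCircle (t : 𝕋) : ℂ).im = Real.sin (2 * Real.pi * t) := by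
  rw [AddCircle.toCircle_apply_mk, Circle.coe_exp, Complex.exp_ofReal_mul_I_im, div_one]

theorem exists_toCircle_mul_eq_norm (z : ℂ) : ∃ t : 𝕋, (toCircle t : ℂ) * z = ‖z‖ := by
  obtain ⟨t, ht⟩ := (AddCircle.homeomorphCircle (one_ne_zero (α := ℝ))).surjective
    (Circle.exp (-z.arg))
  refine ⟨t, ?_⟩
  rw [← AddCircle.homeomorphCircle_apply one_ne_zero, ht, Circle.coe_exp]
  nth_rw 2 [← Complex.norm_mul_exp_arg_mul_I z]
  rw [mul_left_comm, ← Complex.exp_add, Complex.ofReal_neg, neg_mul, neg_add_cancel,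
    Complex.exp_zero, mul_one]

instance isFiniteMeasure_sphereVolume : IsFiniteMeasure (sphereVolume n) :=
  inferInstanceAs (IsFiniteMeasure (Measure.toSphere _))

instance isOpenPosMeasure_sphereVolume : (sphereVolume n).IsOpenPosMeasure :=
  inferInstanceAs (Measure.toSphere _).IsOpenPosMeasure

theorem dotForm_coe_self (x : OddSphere n) : dotForm (x : EvenSpace ℝ n) x = 1 := by
  rw [dotForm_self_eq_norm_sq, norm_eq_of_mem_sphere, one_pow]

theorem norm_twist {P : Module.End ℝ (EvenSpace ℝ n)} (hP : IsInvariantProj P) {c s : ℝ}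
    (h : c ^ 2 + s ^ 2 = 1) (x : EvenSpace ℝ n) : ‖twist P c s x‖ = ‖x‖ := by
  rw [← sq_eq_sq₀ (norm_nonneg _) (norm_nonneg _), ← dotForm_self_eq_norm_sq,
    ← dotForm_self_eq_norm_sq, hP.dotForm_twist_self h]

/-- The circle action on the sphere that rotates the range of an invariant projection and fixes
its complement. -/
def sphereFlow {P : Module.End ℝ (EvenSpace ℝ n)} (hP : IsInvariantProj P) :
    Flow 𝕋 (OddSphere n) where
  toFun t x := ⟨twist P (toCircle t : ℂ).re (toCircle t : ℂ).im x, by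
    rw [mem_sphere_zero_iff_norm, norm_twist hP (toCircle_re_sq_add_im_sq t),
      norm_eq_of_mem_sphere]⟩
  cont' := by
    have hP' := P.continuous_of_finiteDimensional
    have hJ := (quarterTurn ℝ n).continuous_of_finiteDimensional
    refine continuous_induced_rng.2 ?_
    simp only [Function.comp_def, Function.uncurry, twist_apply, rotationMap_apply]
    fun_prop
  map_add' t s x := Subtype.ext <| by
    simp only [← Module.End.mul_apply, hP.twist_mul_twist, AddCircle.toCircle_add, Circle.coe_mul,
      Complex.mul_re, Complex.mul_im]
  map_zero' x := Subtype.ext <| by simp [twist_one_zero]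

theorem coe_sphereFlow {P : Module.End ℝ (EvenSpace ℝ n)} (hP : IsInvariantProj P) (t : 𝕋)
    (x : OddSphere n) :
    (sphereFlow hP t x : EvenSpace ℝ n) = twist P (toCircle t : ℂ).re (toCircle t : ℂ).im x := rfl

theorem isometry_sphereFlow {P : Module.End ℝ (EvenSpace ℝ n)} (hP : IsInvariantProj P) (t : 𝕋) :
    Isometry (sphereFlow hP t) := Isometry.of_dist_eq fun x y => by
  rw [Subtype.dist_eq, Subtype.dist_eq, coe_sphereFlow, coe_sphereFlow, dist_eq_norm, ← map_sub,
    norm_twist hP (toCircle_re_sq_add_im_sq t), dist_eq_norm]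

theorem measurePreserving_sphereFlow {P : Module.End ℝ (EvenSpace ℝ n)} (hP : IsInvariantProj P)
    (t : 𝕋) : MeasurePreserving (sphereFlow hP t) (sphereVolume n) (sphereVolume n) :=
  measurePreserving_toSphere
    (LinearIsometry.toLinearIsometryEquiv
      ⟨twist P (toCircle t : ℂ).re (toCircle t : ℂ).im,
        norm_twist hP (toCircle_re_sq_add_im_sq t)⟩ rfl) (coe_sphereFlow hP t)

/-- The circle action `φ` on the sphere as a flow of the circle `ℝ / ℤ`. -/
def circleAction (n : ℕ) : Flow 𝕋 (OddSphere n) := sphereFlow isInvariantProj_one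

theorem coe_circleAction (t : 𝕋) (x : OddSphere n) : (circleAction n t x : EvenSpace ℝ n) =
    rotationMap (toCircle t : ℂ).re (toCircle t : ℂ).im x := by
  rw [circleAction, coe_sphereFlow, twist_one]

theorem sphereRotation_eq_circleAction (t : ℝ) (x : OddSphere n) :
    sphereRotation t x = circleAction n t x := Subtype.ext <| by
  rw [coe_circleAction, coe_toCircle_re, coe_toCircle_im]
  exact planeRotation_eq_rotationMap t _

theorem sphereFlow_circleAction {P : Module.End ℝ (EvenSpace ℝ n)} (hP : IsInvariantProj P)
    (s t : 𝕋) (x : OddSphere n) :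
    sphereFlow hP s (circleAction n t x) = circleAction n t (sphereFlow hP s x) :=
  Subtype.ext <| by
    rw [coe_sphereFlow, coe_circleAction, coe_circleAction, coe_sphereFlow]
    exact (LinearMap.congr_fun (hP.commute_rotationMap_twist ..) (x : EvenSpace ℝ n)).symm

/-- The circle action that fixes the plane spanned by `u` and its quarter turn and rotates its
orthogonal complement. -/
def twistFlow (u : OddSphere n) : Flow 𝕋 (OddSphere n) :=
  sphereFlow (isInvariantProj_perpProj (dotForm_coe_self u))

theorem coe_twistFlow (u : OddSphere n) (t : 𝕋) (x : OddSphere n) :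
    (twistFlow u t x : EvenSpace ℝ n) =
      twist (perpProj (u : EvenSpace ℝ n)) (toCircle t : ℂ).re (toCircle t : ℂ).im x := rfl

/-- The complex coordinate on the plane spanned by `u` and its quarter turn. -/
def planeCoord (u : OddSphere n) : C(OddSphere n, ℂ) where
  toFun x := dotForm (u : EvenSpace ℝ n) x +
    dotForm (quarterTurn ℝ n u) (x : EvenSpace ℝ n) * Complex.I
  continuous_toFun := by
    have h := fun v : EvenSpace ℝ n => (dotForm v).continuous_of_finiteDimensional
    fun_prop

theorem planeCoord_apply (u x : OddSphere n) : planeCoord u x =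
    dotForm (u : EvenSpace ℝ n) x + dotForm (quarterTurn ℝ n u) (x : EvenSpace ℝ n) * Complex.I :=
  rfl

theorem planeCoord_circleAction (u : OddSphere n) (t : 𝕋) (x : OddSphere n) :
    planeCoord u (circleAction n t x) = toCircle t * planeCoord u x := by
  simp only [planeCoord_apply, coe_circleAction, dotForm_quarterTurn_rotationMap,
    dotForm_rotationMap (u := (u : EvenSpace ℝ n))]
  apply Complex.ext <;> simp

theorem planeCoord_twistFlow (u : OddSphere n) (t : 𝕋) (x : OddSphere n) :
    planeCoord u (twistFlow u t x) = planeCoord u x := by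
  have hu := dotForm_coe_self u
  rw [planeCoord_apply, coe_twistFlow, (isInvariantProj_perpProj hu).dotForm_twist
    (perpProj_self hu), (isInvariantProj_perpProj hu).dotForm_twist
    (perpProj_quarterTurn_self hu), planeCoord_apply]

theorem twistFlow_of_planeCoord_eq_zero (u : OddSphere n) (t : 𝕋) {x : OddSphere n}
    (hx : planeCoord u x = 0) : twistFlow u t x = circleAction n t x := Subtype.ext <| by
  obtain ⟨hu, hJu⟩ := Complex.ext_iff.1 hx
  have hfix : perpProj (u : EvenSpace ℝ n) x = x := by
    simp only [planeCoord_apply, Complex.add_re, Complex.add_im, Complex.re_ofReal_mul,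
      Complex.im_ofReal_mul, Complex.ofReal_re, Complex.ofReal_im, Complex.I_re, Complex.I_im,
      mul_zero, mul_one, add_zero, zero_add, Complex.zero_re, Complex.zero_im] at hu hJu
    rw [perpProj_apply, hu, hJu, zero_smul, zero_smul, sub_zero, sub_zero]
  rw [coe_twistFlow, twist_apply_of_apply_eq_self hfix, coe_circleAction]

theorem exists_twistFlow_half_eq {x y : OddSphere n} (h0 : 0 ≤ dotForm (x : EvenSpace ℝ n) y)
    (h1 : dotForm (quarterTurn ℝ n x) (y : EvenSpace ℝ n) = 0) :
    ∃ u, twistFlow u ((1 / 2 : ℝ) : 𝕋) x = y := by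
  set v : EvenSpace ℝ n := x + y with hv
  have hxv : dotForm (x : EvenSpace ℝ n) v = 1 + dotForm (x : EvenSpace ℝ n) y := by
    rw [hv, map_add, dotForm_coe_self]
  have hnorm : ‖v‖ ^ 2 = 2 * dotForm (x : EvenSpace ℝ n) v := by
    rw [← dotForm_self_eq_norm_sq, hxv, hv]
    simp only [map_add, LinearMap.add_apply, dotForm_coe_self, dotForm_comm (y : EvenSpace ℝ n) x]
    ring
  have hv0 : ‖v‖ ≠ 0 := fun h => by
    rw [h] at hnorm
    linarith
  have hJ : dotForm (quarterTurn ℝ n v) (x : EvenSpace ℝ n) = 0 := by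
    rw [dotForm_comm, hv, map_add, map_add, dotForm_quarterTurn_self, zero_add,
      ← neg_eq_zero, ← dotForm_quarterTurn_left, h1]
  have hhalf : (toCircle ((1 / 2 : ℝ) : 𝕋) : ℂ) = -1 := by
    apply Complex.ext <;> simp [coe_toCircle_re, coe_toCircle_im, mul_comm 2 Real.pi]
  refine ⟨⟨‖v‖⁻¹ • v, by simp [norm_smul, hv0]⟩, Subtype.ext ?_⟩
  rw [coe_twistFlow, hhalf]
  simp only [twist_apply, rotationMap_apply, perpProj_apply, map_smul, LinearMap.smul_apply, hJ,
    dotForm_comm v, Complex.neg_re, Complex.one_re, Complex.neg_im, Complex.one_im, neg_zero,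
    smul_eq_mul, mul_zero, zero_smul, add_zero, smul_smul]
  rw [show ‖v‖⁻¹ * dotForm (x : EvenSpace ℝ n) v * ‖v‖⁻¹ = 1 / 2 by
    field_simp; linarith, hv]
  module

theorem exists_twistFlow_eq_circleAction (x y : OddSphere n) :
    ∃ u s t, twistFlow u s x = circleAction n t y := by
  obtain ⟨t, ht⟩ := exists_toCircle_mul_eq_norm (planeCoord x y)
  have hcoord := Complex.ext_iff.1 ((planeCoord_circleAction x t y).trans ht)
  simp only [planeCoord_apply, Complex.add_re, Complex.ofReal_re, Complex.mul_re, Complex.I_re,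
    mul_zero, Complex.ofReal_im, Complex.I_im, mul_one, sub_self, add_zero, Complex.add_im,
    Complex.mul_im, zero_add] at hcoord
  obtain ⟨u, hu⟩ := exists_twistFlow_half_eq (hcoord.1.symm ▸ norm_nonneg _) hcoord.2
  exact ⟨u, _, t, hu⟩

end SphereFlow

section SphereShear

variable {n : ℕ}

theorem toCircle_ratCast_pow_eq_one {α : ℚ} {q : ℕ} (h : α.den ∣ q) :
    (toCircle ((α : ℝ) : 𝕋) : ℂ) ^ q = 1 := by
  obtain ⟨m, rfl⟩ := h
  have hint : ((α.den * m) • (α : ℝ) : ℝ) = (m * α.num : ℤ) • (1 : ℝ) := by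
    rw [nsmul_eq_mul, zsmul_eq_mul, mul_one]
    have hrat : (α : ℝ) * α.den = α.num := mod_cast α.mul_den_eq_num
    push_cast
    linear_combination (m : ℝ) * hrat
  rw [← Circle.coe_pow, ← AddCircle.toCircle_nsmul, ← AddCircle.coe_nsmul, hint,
    AddCircle.coe_zsmul, AddCircle.coe_period, zsmul_zero, AddCircle.toCircle_zero, Circle.coe_one]

/-- The polynomial on `ℂ^{2n}` that restricts to `M * re (w ^ q)` on the sphere, where `w` is the
coordinate `planeCoord u`. -/
def complexPhase (u : OddSphere n) (q : ℕ) (M : ℝ) (z : EvenSpace ℂ n) : ℂ :=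
  M * (((dotForm (complexify u) z + dotForm (quarterTurn ℂ n (complexify u)) z * Complex.I) ^ q +
    (dotForm (complexify u) z - dotForm (quarterTurn ℂ n (complexify u)) z * Complex.I) ^ q) / 2)

theorem complexPhase_complexify (u : OddSphere n) (q : ℕ) (M : ℝ) (x : OddSphere n) :
    complexPhase u q M (complexify x) = ((M * (planeCoord u x ^ q).re : ℝ) : ℂ) := by
  rw [complexPhase, quarterTurn_complexify, dotForm_complexify, dotForm_complexify,
    Complex.ofReal_mul, Complex.re_eq_add_conj, map_pow, planeCoord_apply]
  simp [sub_eq_add_neg]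

theorem dotForm_complexify_self (u : OddSphere n) :
    dotForm (complexify (u : EvenSpace ℝ n)) (complexify u) = 1 := by
  rw [dotForm_complexify, dotForm_coe_self, Complex.ofReal_one]

theorem complexPhase_twist (u : OddSphere n) (q : ℕ) (M : ℝ) (c s : ℂ) (z : EvenSpace ℂ n) :
    complexPhase u q M (twist (perpProj (complexify u)) c s z) = complexPhase u q M z := by
  have hu := dotForm_complexify_self u
  rw [complexPhase, (isInvariantProj_perpProj hu).dotForm_twist (perpProj_self hu),
    (isInvariantProj_perpProj hu).dotForm_twist (perpProj_quarterTurn_self hu), complexPhase]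

theorem complexPhase_planeRotation (u : OddSphere n) {α : ℚ} {q : ℕ} (hq : α.den ∣ q) (M : ℝ)
    (z : EvenSpace ℂ n) : complexPhase u q M (planeRotation ℂ α z) = complexPhase u q M z := by
  set ζ := (toCircle ((α : ℝ) : 𝕋) : ℂ)
  have hζ : (ζ.re + ζ.im * Complex.I) ^ q = 1 := by
    rw [Complex.re_add_im, toCircle_ratCast_pow_eq_one hq]
  have hζ' : (ζ.re - ζ.im * Complex.I) ^ q = 1 := by
    rw [← map_one (starRingEnd ℂ), ← hζ]
    simp only [map_pow, map_add, map_mul, Complex.conj_ofReal, Complex.conj_I, mul_neg,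
      sub_eq_add_neg]
  have hrot : planeRotation ℂ (α : ℝ) z = rotationMap (ζ.re : ℂ) (ζ.im : ℂ) z := by
    rw [coe_toCircle_re, coe_toCircle_im]
    exact planeRotation_eq_rotationMap _ z
  rw [hrot, complexPhase, complexPhase, dotForm_quarterTurn_rotationMap, dotForm_rotationMap]
  set a := dotForm (complexify (u : EvenSpace ℝ n)) z
  set b := dotForm (quarterTurn ℂ n (complexify (u : EvenSpace ℝ n))) z
  have hol : ζ.re * a - ζ.im * b + (ζ.re * b + ζ.im * a) * Complex.I =
      (ζ.re + ζ.im * Complex.I) * (a + b * Complex.I) := by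
    linear_combination (-ζ.im * b) * Complex.I_sq
  have anti : ζ.re * a - ζ.im * b - (ζ.re * b + ζ.im * a) * Complex.I =
      (ζ.re - ζ.im * Complex.I) * (a - b * Complex.I) := by
    linear_combination (-ζ.im * b) * Complex.I_sq
  rw [hol, anti, mul_pow, mul_pow, hζ, hζ', one_mul, one_mul]

theorem complexPhase_neg (u : OddSphere n) (q : ℕ) (M : ℝ) (z : EvenSpace ℂ n) :
    complexPhase u q (-M) z = -complexPhase u q M z := by
  simp [complexPhase]

/-- The holomorphic extension of the shear of the sphere that moves `x` for the time
`M * re (w ^ q)` along the flow `twistFlow u`, where `w = planeCoord u x`. -/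
def complexShear (u : OddSphere n) (q : ℕ) (M : ℝ) (z : EvenSpace ℂ n) : EvenSpace ℂ n :=
  twist (perpProj (complexify u)) (Complex.cos (2 * Real.pi * complexPhase u q M z))
    (Complex.sin (2 * Real.pi * complexPhase u q M z)) z

theorem complexShear_neg_complexShear (u : OddSphere n) (q : ℕ) (M : ℝ) (z : EvenSpace ℂ n) :
    complexShear u q (-M) (complexShear u q M z) = z := by
  simp only [complexShear, complexPhase_twist, complexPhase_neg, mul_neg, Complex.cos_neg,
    Complex.sin_neg, ← Module.End.mul_apply,
    (isInvariantProj_perpProj (dotForm_complexify_self u)).twist_mul_twist]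
  rw [neg_mul, sub_neg_eq_add, ← sq, ← sq, Complex.cos_sq_add_sin_sq,
    mul_comm (Complex.cos _), ← add_mul, add_neg_cancel, zero_mul, twist_one_zero,
    Module.End.one_apply]

theorem differentiable_complexShear (u : OddSphere n) (q : ℕ) (M : ℝ) :
    Differentiable ℂ (complexShear u q M) := by
  have hdot := fun v : EvenSpace ℂ n => (dotForm v).toContinuousLinearMap.differentiable
  have hJ := (LinearMap.toContinuousLinearMap (quarterTurn ℂ n)).differentiable
  have hP := (LinearMap.toContinuousLinearMap
    (perpProj (complexify (u : EvenSpace ℝ n)))).differentiable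
  simp only [LinearMap.coe_toContinuousLinearMap'] at hdot hJ hP
  unfold complexShear
  simp only [twist_apply, rotationMap_apply, complexPhase]
  fun_prop

theorem complexShear_complexify (u : OddSphere n) (q : ℕ) (M : ℝ) (x : OddSphere n) :
    complexShear u q M (complexify x) =
      complexify (twistFlow u ((M * (planeCoord u x ^ q).re : ℝ) : 𝕋) x : OddSphere n) := by
  rw [complexShear, complexPhase_complexify, coe_twistFlow, ← twist_perpProj_complexify,
    coe_toCircle_re, coe_toCircle_im]
  push_cast
  rfl

theorem commute_complexShear_planeRotation (u : OddSphere n) {α : ℚ} {q : ℕ} (hq : α.den ∣ q)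
    (M : ℝ) : Function.Commute (complexShear u q M) (planeRotation ℂ α) := fun z => by
  rw [complexShear, complexPhase_planeRotation u hq, planeRotation_eq_rotationMap,
    planeRotation_eq_rotationMap, complexShear]
  exact (LinearMap.congr_fun ((isInvariantProj_perpProj
    (dotForm_complexify_self u)).commute_rotationMap_twist ..) z).symm

theorem twistFlow_neg_twistFlow (u : OddSphere n) (q : ℕ) (M : ℝ) (x : OddSphere n) :
    twistFlow u ((-M * (planeCoord u (twistFlow u ((M * (planeCoord u x ^ q).re : ℝ) : 𝕋) x)
      ^ q).re : ℝ) : 𝕋) (twistFlow u ((M * (planeCoord u x ^ q).re : ℝ) : 𝕋) x) = x := by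
  rw [planeCoord_twistFlow, ← Flow.map_add, ← AddCircle.coe_add, neg_mul, neg_add_cancel,
    AddCircle.coe_zero, Flow.map_zero_apply]

/-- The shear that moves `x` for the time `M * re (w ^ q)` along the flow `twistFlow u`, where
`w = planeCoord u x`, as an entire diffeomorphism. -/
def shear (u : OddSphere n) (q : ℕ) (M : ℝ) : EntDiffeo n where
  toHomeo :=
    { toFun := fun x => twistFlow u ((M * (planeCoord u x ^ q).re : ℝ) : 𝕋) x
      invFun := fun x => twistFlow u ((-M * (planeCoord u x ^ q).re : ℝ) : 𝕋) x
      left_inv := twistFlow_neg_twistFlow u q M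
      right_inv := fun x => by simpa using twistFlow_neg_twistFlow u q (-M) x
      continuous_toFun := (twistFlow u).continuous (by fun_prop) continuous_id
      continuous_invFun := (twistFlow u).continuous (by fun_prop) continuous_id }
  ext := complexShear u q M
  extInv := complexShear u q (-M)
  holo_ext := (differentiable_complexShear u q M).holomorphicNear _
  holo_extInv := (differentiable_complexShear u q (-M)).holomorphicNear _
  ext_apply := complexShear_complexify u q M
  extInv_apply := complexShear_complexify u q (-M)

/-- The entire diffeomorphisms used as conjugations: they preserve the volume, and the chosen
extension of the inverse is a right inverse of the extension on all of `ℂ^{2n}`. -/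
structure IsRegularDiffeo (h : EntDiffeo n) : Prop where
  ext_extInv : ∀ z, h.ext (h.extInv z) = z
  volumePreserving : h.VolumePreserving

theorem IsRegularDiffeo.comp {f g : EntDiffeo n} (hf : IsRegularDiffeo f)
    (hg : IsRegularDiffeo g) : IsRegularDiffeo (EntDiffeo.comp f g) where
  ext_extInv z := by simp [EntDiffeo.comp, hg.ext_extInv, hf.ext_extInv]
  volumePreserving :=
    MeasurePreserving.comp (g := f.toHomeo) hf.volumePreserving hg.volumePreserving

theorem isRegularDiffeo_shear (u : OddSphere n) (q : ℕ) (M : ℝ) :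
    IsRegularDiffeo (shear u q M) where
  ext_extInv z := by simpa [shear] using complexShear_neg_complexShear u q (-M) z
  volumePreserving := measurePreserving_flow_of_invariant (measurePreserving_sphereFlow _)
    (ψ := fun x => ((M * (planeCoord u x ^ q).re : ℝ) : 𝕋))
    (Continuous.measurable (by fun_prop))
    fun s x => by rw [← twistFlow, planeCoord_twistFlow]

theorem isRegularDiffeo_circleFlow (t : ℝ) : IsRegularDiffeo (circleFlow n t) where
  ext_extInv z := by simp [circleFlow, ← planeRotation_add, planeRotation_zero]
  volumePreserving := by
    have h : ⇑(circleFlow n t).toHomeo = circleAction n t :=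
      funext (sphereRotation_eq_circleAction t)
    rw [HolDiffeo.VolumePreserving, h]
    exact measurePreserving_sphereFlow _ _

theorem exists_isRegularDiffeo_avg_near_avgList (L : List (OddSphere n)) (F : C(OddSphere n, ℝ))
    {ε : ℝ} (hε : 0 < ε) (α : ℚ) :
    ∃ h : EntDiffeo n, IsRegularDiffeo h ∧ Function.Commute h.ext (planeRotation ℂ α) ∧ ∀ x,
      |(∫ t, F (h.toHomeo (circleAction n t x))) -
        avgList twistFlow L (orbitAvg (circleAction n) F) x| ≤ ε := by
  induction L generalizing ε with
  | nil =>
    refine ⟨circleFlow n 0, isRegularDiffeo_circleFlow 0, fun z => ?_, fun x => ?_⟩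
    · simp only [circleFlow, planeRotation_zero]
    · have hid (y : OddSphere n) : (circleFlow n 0).toHomeo y = y :=
        Subtype.ext (planeRotation_zero _)
      simp only [hid, avgList, List.foldr_nil, orbitAvg_apply, sub_self, abs_zero, hε.le]
  | cons u L ih =>
    obtain ⟨h, hreg, hcomm, happrox⟩ := ih (half_pos hε)
    set F' : C(OddSphere n, ℝ) := F.comp h.toHomeo
    obtain ⟨q, M, hαq, hshear⟩ := exists_shear_avg (sphereFlow_circleAction _)
      (planeCoord_circleAction u) (fun s _ => twistFlow_of_planeCoord_eq_zero u s) F'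
      (half_pos hε) α.den_pos
    refine ⟨EntDiffeo.comp h (shear u q M), hreg.comp (isRegularDiffeo_shear u q M),
      hcomm.comp_left (commute_complexShear_planeRotation u hαq M), fun x => ?_⟩
    have havg : |orbitAvg (twistFlow u) (orbitAvg (circleAction n) F') x -
        avgList twistFlow (u :: L) (orbitAvg (circleAction n) F) x| ≤ ε / 2 :=
      abs_orbitAvg_sub_orbitAvg_le (twistFlow u) fun s => happrox (twistFlow u s x)
    exact (abs_sub_le _ _ _).trans ((add_le_add (hshear x) havg).trans_eq (add_halves ε))

theorem exists_isRegularDiffeo_avg_near_const (F : C(OddSphere n, ℝ)) {ε : ℝ} (hε : 0 < ε)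
    (α : ℚ) :
    ∃ h : EntDiffeo n, IsRegularDiffeo h ∧ Function.Commute h.ext (planeRotation ℂ α) ∧
      ∃ c : ℝ, ∀ x, |(∫ t, F (h.toHomeo (circleAction n t x))) - c| ≤ ε := by
  obtain ⟨L, c, hL⟩ := exists_avgList_near_const (circleAction n) (T := twistFlow)
    (fun u => sphereFlow_circleAction _) (fun u => isometry_sphereFlow _)
    exists_twistFlow_eq_circleAction (orbitAvg_flow_apply (circleAction n) F) (half_pos hε)
  obtain ⟨h, hreg, hcomm, happrox⟩ :=
    exists_isRegularDiffeo_avg_near_avgList L F (half_pos hε) α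
  exact ⟨h, hreg, hcomm, c, fun x =>
    (abs_sub_le _ _ _).trans ((add_le_add (happrox x) (hL x)).trans_eq (add_halves ε))⟩

end SphereShear

section NearlyConstantMeans

variable {X : Type*}

/-- The averages of `F` along the orbits of some power of `f` are `η`-close to a constant. -/
def HasNearlyConstantMeans (f : X → X) (F : X → ℝ) (η : ℝ) : Prop :=
  ∃ m r : ℕ, 0 < r ∧ ∃ c, ∀ x, |birkhoffAverage ℝ f^[m] F r x - c| < η

theorem abs_birkhoffAverage_sub_le {f : X → X} {F G : X → ℝ} {δ : ℝ} (h : ∀ x, |F x - G x| ≤ δ)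
    {r : ℕ} (hr : 0 < r) (x : X) :
    |birkhoffAverage ℝ f F r x - birkhoffAverage ℝ f G r x| ≤ δ := by
  rw [← Pi.sub_apply, ← Pi.sub_apply, ← birkhoffAverage_sub, birkhoffAverage, birkhoffSum,
    smul_eq_mul, abs_mul, abs_inv, Nat.abs_cast, inv_mul_le_iff₀ (by positivity)]
  exact (Finset.abs_sum_le_sum_abs _ _).trans
    ((Finset.sum_le_card_nsmul _ _ δ fun i _ => h _).trans (by simp))

theorem HasNearlyConstantMeans.of_near {f : X → X} {F G : X → ℝ} {η δ : ℝ}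
    (h : HasNearlyConstantMeans f F η) (hFG : ∀ x, |G x - F x| ≤ δ) :
    HasNearlyConstantMeans f G (δ + η) := by
  obtain ⟨m, r, hr, c, hc⟩ := h
  exact ⟨m, r, hr, c, fun x => (abs_sub_le _ _ _).trans_lt
    (add_lt_add_of_le_of_lt (abs_birkhoffAverage_sub_le hFG hr x) (hc x))⟩

theorem HasNearlyConstantMeans.of_semiconj {Y : Type*} {g : Y → Y} {f : X → X} {h : Y → X}
    (hfg : Function.Semiconj h g f) (hh : Function.Surjective h) {F : X → ℝ} {η : ℝ}
    (hF : HasNearlyConstantMeans g (F ∘ h) η) : HasNearlyConstantMeans f F η := by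
  obtain ⟨m, r, hr, c, hc⟩ := hF
  refine ⟨m, r, hr, c, hh.forall.2 fun y => ?_⟩
  have hiter := fun i => ((hfg.iterate_right m).iterate_right i).eq y
  simpa only [birkhoffAverage, birkhoffSum, Function.comp_apply, hiter] using hc y

theorem hasNearlyConstantMeans_of_denseRange [TopologicalSpace X] [CompactSpace X] {ι : Type*}
    {f : X → X} {Q : ι → C(X, ℝ) × Set.Ioi (0 : ℝ)} (hQ : DenseRange Q)
    (h : ∀ i, HasNearlyConstantMeans f (Q i).1 (Q i).2) (F : C(X, ℝ)) {η : ℝ} (hη : 0 < η) :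
    HasNearlyConstantMeans f F η := by
  have hopen : IsOpen {p : C(X, ℝ) × Set.Ioi (0 : ℝ) | dist F p.1 + p.2 < η} :=
    isOpen_lt (by fun_prop) continuous_const
  obtain ⟨i, hi : dist F (Q i).1 + (Q i).2 < η⟩ := hQ.exists_mem_open hopen
    ⟨(F, ⟨η / 2, half_pos hη⟩), by simpa using half_lt_self hη⟩
  obtain ⟨m, r, hr, c, hc⟩ := (h i).of_near fun x =>
    (Real.dist_eq _ _).symm.trans_le (ContinuousMap.dist_apply_le_dist (f := F) x)
  exact ⟨m, r, hr, c, fun x => (hc x).trans hi⟩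

theorem continuous_birkhoffAverage [TopologicalSpace X] {Y : Type*} [TopologicalSpace Y]
    {f : Y → X → X} (hf : Continuous fun p : Y × X => f p.1 p.2) (F : C(X, ℝ)) (m r : ℕ) :
    Continuous fun p : Y × X => birkhoffAverage ℝ (f p.1)^[m] F r p.2 := by
  have hiter (k : ℕ) : Continuous fun p : Y × X => (f p.1)^[k] p.2 := by
    induction k with
    | zero => exact continuous_snd
    | succ k ih =>
      simp only [Function.iterate_succ_apply']
      exact hf.comp (continuous_fst.prodMk ih)
  simp only [birkhoffAverage, birkhoffSum, ← Function.iterate_mul]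
  have := fun k => F.continuous.comp (hiter k)
  fun_prop

theorem isOpen_setOf_hasNearlyConstantMeans [TopologicalSpace X] [CompactSpace X] [T2Space X]
    (F : C(X, ℝ)) (η : ℝ) : IsOpen {f : C(X, X) | HasNearlyConstantMeans f F η} := by
  refine isOpen_iff_mem_nhds.2 fun f ⟨m, r, hr, c, hc⟩ => ?_
  have hcont : Continuous fun p : C(X, X) × X => |birkhoffAverage ℝ p.1^[m] F r p.2 - c| :=
    ((continuous_birkhoffAverage (by fun_prop) F m r).sub continuous_const).abs
  have hnear : ∀ᶠ g : C(X, X) in 𝓝 f, ∀ x ∈ Set.univ, |birkhoffAverage ℝ g^[m] F r x - c| < η :=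
    isCompact_univ.eventually_forall_of_forall_eventually fun x _ =>
      hcont.continuousAt.eventually_lt_const (hc x)
  filter_upwards [hnear] with g hg
  exact ⟨m, r, hr, c, fun x => hg x trivial⟩

theorem exists_pos_hasNearlyConstantMeans_of_edist_le [MetricSpace X] [CompactSpace X] {f : C(X, X)}
    {F : C(X, ℝ)} {η : ℝ} (h : HasNearlyConstantMeans f F η) :
    ∃ δ : ℝ≥0∞, 0 < δ ∧
      ∀ g : C(X, X), (∀ x, edist (g x) (f x) ≤ δ) → HasNearlyConstantMeans g F η := by
  obtain ⟨δ, hδ, hball⟩ :=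
    Metric.nhds_basis_closedBall.mem_iff.1 ((isOpen_setOf_hasNearlyConstantMeans F η).mem_nhds h)
  exact ⟨ENNReal.ofReal δ, ENNReal.ofReal_pos.2 hδ, fun g hg =>
    hball ((ContinuousMap.dist_le hδ.le).2 fun x => (edist_le_ofReal hδ.le).1 (hg x))⟩

end NearlyConstantMeans

section Ergodicity

variable {X : Type*} [TopologicalSpace X] [CompactSpace X] [MeasurableSpace X] [BorelSpace X]

theorem integral_birkhoffAverage {f : X → X} {μ : Measure X} [IsFiniteMeasure μ]
    (hf : MeasurePreserving f μ μ) (F : C(X, ℝ)) {r : ℕ} (hr : 0 < r) :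
    ∫ x, birkhoffAverage ℝ f F r x ∂μ = ∫ x, F x ∂μ := by
  have hF : Integrable F μ := integrable_of_continuous F.continuous
  have hiter (k : ℕ) : ∫ x, F (f^[k] x) ∂μ = ∫ x, F x ∂μ := by
    conv_rhs => rw [← (hf.iterate k).map_eq]
    exact (integral_map (hf.iterate k).aemeasurable F.continuous.aestronglyMeasurable).symm
  simp only [birkhoffAverage, birkhoffSum, integral_smul]
  rw [integral_finsetSum (f := fun k x => F (f^[k] x)) _ fun k _ =>
    (hf.iterate k).integrable_comp_of_integrable hF]
  simp only [hiter, Finset.sum_const, Finset.card_range, nsmul_eq_mul, smul_eq_mul]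
  exact inv_mul_cancel_left₀ (by positivity) _

theorem abs_integral_sub_le_of_birkhoffAverage {f : X → X} {μ : Measure X} [IsProbabilityMeasure μ]
    (hf : Continuous f) (hμ : MeasurePreserving f μ μ) (F : C(X, ℝ)) {m r : ℕ} (hr : 0 < r)
    {c η : ℝ} (hc : ∀ x, |birkhoffAverage ℝ f^[m] F r x - c| < η) : |∫ x, F x ∂μ - c| ≤ η := by
  have hcont : Continuous (birkhoffAverage ℝ f^[m] F r) :=
    (continuous_birkhoffAverage (Y := Unit) (f := fun _ => f) (by fun_prop) F m r).comp
      (Continuous.prodMk_right ())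
  rw [← integral_birkhoffAverage (hμ.iterate m) F hr]
  simpa using abs_integral_sub_integral_le (μ := μ) (integrable_of_continuous hcont)
    (integrable_const c) fun x => (hc x).le

theorem uniquelyErgodic_of_hasNearlyConstantMeans [HasOuterApproxClosed X] {f : X → X}
    (hf : Continuous f) {μ : Measure X} [IsProbabilityMeasure μ] (hμ : MeasurePreserving f μ μ)
    (h : ∀ (F : C(X, ℝ)) (η : ℝ), 0 < η → HasNearlyConstantMeans f F η) : UniquelyErgodic f := by
  refine ⟨μ, ⟨inferInstance, hμ⟩, ?_⟩
  rintro ν ⟨hν, hνf⟩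
  refine ext_of_forall_integral_eq_of_IsFiniteMeasure fun F => eq_of_forall_dist_le fun η hη => ?_
  obtain ⟨m, r, hr, c, hc⟩ := h F.toContinuousMap (η / 2) (half_pos hη)
  have hνc := abs_integral_sub_le_of_birkhoffAverage hf hνf _ hr hc
  have hμc := abs_integral_sub_le_of_birkhoffAverage hf hμ _ hr hc
  rw [abs_sub_comm] at hμc
  exact (abs_sub_le _ c _).trans ((add_le_add hνc hμc).trans_eq (add_halves η))

theorem minimalHomeo_of_hasNearlyConstantMeans [T2Space X] {f : X ≃ₜ X} {μ : Measure X}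
    [IsProbabilityMeasure μ] [μ.IsOpenPosMeasure] (hμ : MeasurePreserving f μ μ)
    (h : ∀ (F : C(X, ℝ)) (η : ℝ), 0 < η → HasNearlyConstantMeans f F η) : MinimalHomeo f := by
  intro x
  by_contra hdense
  obtain ⟨y, hy⟩ := not_forall.1 hdense
  obtain ⟨F, hF0, hF1, hF⟩ := exists_continuous_zero_one_of_isClosed
    (isClosed_closure (s := Set.range fun k : ℤ => (f ^ k) x)) (isClosed_singleton (x := y))
    (Set.disjoint_singleton_right.2 hy)
  have hpow (k : ℕ) : f^[k] x = (f ^ (k : ℤ)) x := by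
    induction k with
    | zero => rfl
    | succ k ih =>
      rw [Function.iterate_succ_apply', ih, Nat.cast_succ, add_comm, zpow_one_add]
      rfl
  have hzero (k : ℕ) : F (f^[k] x) = 0 := hF0 (subset_closure ⟨k, (hpow k).symm⟩)
  have hpos : 0 < ∫ z, F z ∂μ :=
    F.continuous.integral_pos_of_hasCompactSupport_nonneg_nonzero
      (.of_compactSpace _) (fun z => (hF z).1) (x := y) (by simp [hF1 rfl])
  obtain ⟨m, r, hr, c, hc⟩ := h F _ (half_pos hpos)
  have hmean := abs_integral_sub_le_of_birkhoffAverage f.continuous hμ F hr hc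
  have horbit : birkhoffAverage ℝ f^[m] F r x = 0 := by
    simp [birkhoffAverage, birkhoffSum, ← Function.iterate_mul, hzero]
  have hcx := hc x
  rw [horbit, zero_sub, abs_neg] at hcx
  linarith [le_abs_self c, le_abs_self (∫ z, F z ∂μ - c)]

end Ergodicity

section RiemannSum

theorem abs_sum_div_sub_integral_le {g : ℝ → ℝ} (hg : Continuous g) {r : ℕ} (hr : 0 < r) {ε : ℝ}
    (h : ∀ t, ∀ s ∈ Set.Icc (0 : ℝ) (1 / r), |g (s + t) - g t| ≤ ε) :
    |(∑ i ∈ Finset.range r, g (i / r)) / r - ∫ t in (0 : ℝ)..1, g t| ≤ ε := by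
  have hr' : (0 : ℝ) < r := by positivity
  have hint := fun a b => hg.intervalIntegrable (μ := volume) a b
  have hlen (i : ℕ) : ((i + 1 : ℕ) : ℝ) / r - i / r = 1 / r := by push_cast; ring
  have hterm (i : ℕ) : |g (i / r) / r - ∫ t in (i / r : ℝ)..(i + 1 : ℕ) / r, g t| ≤ ε / r := by
    have hle : (i / r : ℝ) ≤ (i + 1 : ℕ) / r := by gcongr; simp
    have hconst : g (i / r) / r = ∫ _ in (i / r : ℝ)..(i + 1 : ℕ) / r, g (i / r) := by
      rw [intervalIntegral.integral_const, hlen, smul_eq_mul, one_div_mul_eq_div]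
    rw [abs_sub_comm, hconst, ← intervalIntegral.integral_sub (hint _ _) (by simp)]
    refine (intervalIntegral.norm_integral_le_of_norm_le_const (C := ε)
      (f := fun t => g t - g (i / r)) fun t ht => ?_).trans_eq ?_
    · rw [Set.uIoc_of_le hle] at ht
      simpa using h (i / r) (t - i / r) ⟨by linarith [ht.1], by linarith [ht.2, hlen i]⟩
    · rw [hlen, abs_of_pos (by positivity), mul_one_div]
  have hsplit : ∫ t in (0 : ℝ)..1, g t =
      ∑ i ∈ Finset.range r, ∫ t in (i / r : ℝ)..(i + 1 : ℕ) / r, g t := by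
    rw [intervalIntegral.sum_integral_adjacent_intervals (a := fun i : ℕ => (i / r : ℝ))
      fun k _ => hint _ _]
    simp [hr'.ne']
  calc |(∑ i ∈ Finset.range r, g (i / r)) / r - ∫ t in (0 : ℝ)..1, g t|
      ≤ ∑ i ∈ Finset.range r, |g (i / r) / r - ∫ t in (i / r : ℝ)..(i + 1 : ℕ) / r, g t| := by
        rw [hsplit, Finset.sum_div, ← Finset.sum_sub_distrib]
        exact Finset.abs_sum_le_sum_abs _ _
    _ ≤ ∑ _i ∈ Finset.range r, ε / r := Finset.sum_le_sum fun i _ => hterm i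
    _ = ε := by
        rw [Finset.sum_const, Finset.card_range, nsmul_eq_mul, mul_div_cancel₀ _ hr'.ne']

theorem flow_iterate_apply {M X : Type*} [AddMonoid M] [TopologicalSpace M] [ContinuousAdd M]
    [TopologicalSpace X] (φ : Flow M X) (t : M) (k : ℕ) (x : X) : (φ t)^[k] x = φ (k • t) x := by
  induction k with
  | zero => simp
  | succ k ih => rw [Function.iterate_succ_apply', ih, succ_nsmul', φ.map_add]

theorem eventually_hasNearlyConstantMeans_flow {X : Type*} [TopologicalSpace X] [CompactSpace X]
    (φ : Flow 𝕋 X) {F : C(X, ℝ)} {c δ η : ℝ} (hc : ∀ x, |orbitAvg φ F x - c| ≤ δ) (hδ : δ < η) :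
    ∀ᶠ r : ℕ in atTop, ∀ (t : 𝕋) (m : ℕ), m • t = ((1 / r : ℝ) : 𝕋) →
      HasNearlyConstantMeans (φ t) F η := by
  filter_upwards [eventually_gt_atTop 0, eventually_forall_abs_flow_sub_le φ F
    (half_pos (sub_pos.2 hδ))] with r hr hsmall t m hm
  have hiter (i : ℕ) (x : X) : ((φ t)^[m])^[i] x = φ ((i / r : ℝ) : 𝕋) x := by
    rw [← Function.iterate_mul, flow_iterate_apply, mul_comm, mul_smul, hm, ← AddCircle.coe_nsmul]
    simp [div_eq_mul_inv]
  refine ⟨m, r, hr, c, fun x => ?_⟩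
  have hsum := abs_sum_div_sub_integral_le (g := fun t : ℝ => F (φ t x))
    ((continuous_orbit φ F x).comp (AddCircle.continuous_mk' 1)) hr fun t s hs => by
      simpa only [AddCircle.coe_add, φ.map_add] using hsmall s hs (φ t x)
  have hint : ∫ t in (0 : ℝ)..1, F (φ t x) = orbitAvg φ F x := by
    simpa [orbitAvg_apply] using UnitAddCircle.intervalIntegral_preimage 0 fun t => F (φ t x)
  rw [hint] at hsum
  simp only [birkhoffAverage, birkhoffSum, hiter, smul_eq_mul, inv_mul_eq_div]
  linarith [abs_sub_le ((∑ i ∈ Finset.range r, F (φ ((i / r : ℝ) : 𝕋) x)) / r) (orbitAvg φ F x) c,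
    hc x]

end RiemannSum

section UniformLimits

theorem exists_tendstoUniformlyOn_of_edist_le {α β : Type*} [PseudoEMetricSpace β]
    [CompleteSpace β] {F : ℕ → α → β} {s : Set α} {δ : ℕ → ℝ≥0∞} (hδ : Tendsto δ atTop (𝓝 0))
    (hF : ∀ k l, k ≤ l → ∀ x ∈ s, edist (F l x) (F k x) ≤ δ k) :
    ∃ G : α → β, TendstoUniformlyOn F G atTop s ∧ ∀ k, ∀ x ∈ s, edist (G x) (F k x) ≤ δ k := by
  have hlim (x : α) : ∃ y, x ∈ s → Tendsto (fun k => F k x) atTop (𝓝 y) := by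
    by_cases hx : x ∈ s
    · have hcauchy : CauchySeq fun k => F k x := EMetric.cauchySeq_iff'.2 fun ε hε => by
        obtain ⟨k, hk⟩ := (hδ.eventually_lt_const hε).exists
        exact ⟨k, fun l hl => (hF k l hl x hx).trans_lt hk⟩
      exact (cauchySeq_tendsto_of_complete hcauchy).imp fun y hy _ => hy
    · exact ⟨F 0 x, fun h => absurd h hx⟩
  choose G hG using hlim
  have hbound (k : ℕ) (x : α) (hx : x ∈ s) : edist (G x) (F k x) ≤ δ k :=
    le_of_tendsto ((hG x hx).edist tendsto_const_nhds)
      ((eventually_ge_atTop k).mono fun l hl => hF k l hl x hx)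
  refine ⟨G, EMetric.tendstoUniformlyOn_iff.2 fun ε hε => ?_, hbound⟩
  filter_upwards [hδ.eventually_lt_const hε] with k hk x hx using (hbound k x hx).trans_lt hk

theorem exists_homeomorph_tendstoUniformly {X : Type*} [EMetricSpace X] [CompleteSpace X]
    {h : ℕ → X ≃ₜ X} {δ : ℕ → ℝ≥0∞} (hδ : Tendsto δ atTop (𝓝 0))
    (hh : ∀ k l, k ≤ l → ∀ x, edist (h l x) (h k x) ≤ δ k)
    (hsymm : ∀ k l, k ≤ l → ∀ x, edist ((h l).symm x) ((h k).symm x) ≤ δ k) :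
    ∃ H : X ≃ₜ X, TendstoUniformly (fun k => h k) H atTop ∧
      TendstoUniformly (fun k => (h k).symm) H.symm atTop := by
  obtain ⟨f, hf, -⟩ := exists_tendstoUniformlyOn_of_edist_le hδ fun k l hkl x (_ : x ∈ Set.univ) =>
    hh k l hkl x
  obtain ⟨g, hg, -⟩ := exists_tendstoUniformlyOn_of_edist_le hδ fun k l hkl x (_ : x ∈ Set.univ) =>
    hsymm k l hkl x
  rw [tendstoUniformlyOn_univ] at hf hg
  have hfc : Continuous f := hf.continuous (.of_forall fun k => (h k).continuous)
  have hgc : Continuous g := hg.continuous (.of_forall fun k => (h k).symm.continuous)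
  have hgf (x : X) : g (f x) = x :=
    tendsto_nhds_unique (hg.tendsto_comp hgc.continuousAt (hf.tendsto_at x)) (by simp)
  have hfg (x : X) : f (g x) = x :=
    tendsto_nhds_unique (hf.tendsto_comp hfc.continuousAt (hg.tendsto_at x)) (by simp)
  exact ⟨⟨⟨f, g, hgf, hfg⟩, hfc, hgc⟩, hf, hg⟩

variable {E F : Type*} [NormedAddCommGroup E] [NormedSpace ℂ E] [NormedAddCommGroup F]
  [NormedSpace ℂ F]

theorem uniformCauchySeqOn_fderiv {f : ℕ → E → F} {z : E} {r : ℝ} (hr : 0 < r)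
    (hf : ∀ k, DifferentiableOn ℂ (f k) (Metric.ball z (r + r)))
    (hcauchy : UniformCauchySeqOn f atTop (Metric.ball z (r + r))) :
    UniformCauchySeqOn (fun k => fderiv ℂ (f k)) atTop (Metric.ball z r) := by
  refine Metric.uniformCauchySeqOn_iff.2 fun ε hε => ?_
  obtain ⟨N, hN⟩ := Metric.uniformCauchySeqOn_iff.1 hcauchy (ε / 2 * r / 2) (by positivity)
  refine ⟨N, fun k hk l hl w hw => ?_⟩
  have hsub : Metric.ball w r ⊆ Metric.ball z (r + r) :=
    Metric.ball_subset_ball' (by linarith [Metric.mem_ball.1 hw])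
  have hmem : w ∈ Metric.ball z (r + r) := hsub (Metric.mem_ball_self hr)
  have hd (k : ℕ) : DifferentiableAt ℂ (f k) w :=
    (hf k).differentiableAt (Metric.isOpen_ball.mem_nhds hmem)
  have hmaps : Set.MapsTo (f k - f l) (Metric.ball w r)
      (Metric.closedBall ((f k - f l) w) (ε / 2 * r)) := fun v hv => by
    have hvk := hN k hk l hl v (hsub hv)
    have hwk := hN k hk l hl w hmem
    rw [dist_eq_norm] at hvk hwk
    rw [Metric.mem_closedBall, dist_eq_norm]
    exact (norm_sub_le _ _).trans (by simpa using (add_lt_add hvk hwk).le)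
  rw [dist_eq_norm, ← fderiv_sub (hd k) (hd l)]
  calc ‖fderiv ℂ (f k - f l) w‖ ≤ ε / 2 * r / r :=
        Complex.norm_fderiv_le_div_of_mapsTo_ball (((hf k).sub (hf l)).mono hsub) hmaps hr
    _ < ε := by rw [mul_div_cancel_right₀ _ hr.ne']; exact half_lt_self hε

theorem differentiableOn_of_tendstoUniformlyOn [CompleteSpace F] {f : ℕ → E → F} {g : E → F}
    {U : Set E} (hU : IsOpen U) (hf : ∀ k, DifferentiableOn ℂ (f k) U)
    (hfg : TendstoUniformlyOn f g atTop U) : DifferentiableOn ℂ g U := by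
  intro z hz
  obtain ⟨ρ, hρ, hball⟩ := Metric.isOpen_iff.1 hU z hz
  have hr : 0 < ρ / 2 := half_pos hρ
  rw [← add_halves ρ] at hball
  have hsub : Metric.ball z (ρ / 2) ⊆ U :=
    (Metric.ball_subset_ball (le_add_of_nonneg_left hr.le)).trans hball
  have hcauchy := uniformCauchySeqOn_fderiv hr (fun k => (hf k).mono hball)
    (hfg.mono hball).uniformCauchySeqOn
  choose! A hA using fun w hw => cauchySeq_tendsto_of_complete (hcauchy.cauchySeq (x := w) hw)
  have hunif := hcauchy.tendstoUniformlyOn_of_tendsto hA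
  exact (hasFDerivAt_of_tendstoUniformlyOn Metric.isOpen_ball hunif
    (fun k w hw => ((hf k).differentiableAt (hU.mem_nhds (hsub hw))).hasFDerivAt)
    (fun w hw => hfg.tendsto_at (hsub hw))
    (Metric.mem_ball_self hr)).differentiableAt.differentiableWithinAt

end UniformLimits

section HolDist

variable {n : ℕ}

theorem edist_complexify (x y : EvenSpace ℝ n) :
    edist (complexify x) (complexify y) = edist x y := by
  simp [EuclideanSpace.edist_eq, complexify, Complex.isometry_ofReal.edist_eq]

theorem complexify_mem_ball {R : ℝ} (hR : 1 < R) (x : OddSphere n) :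
    complexify (x : EvenSpace ℝ n) ∈ Metric.ball (0 : EvenSpace ℂ n) R := by
  have hnorm (y : EvenSpace ℝ n) : ‖complexify y‖ = ‖y‖ := by
    simp [EuclideanSpace.norm_eq, complexify]
  rwa [mem_ball_zero_iff, hnorm, norm_eq_of_mem_sphere]

variable {K L M N : Set (EvenSpace ℂ n)} {f : HolDiffeo n L} {g : HolDiffeo n M}

theorem HolDiffeo.eq_of_ext_eq {f g : HolDiffeo n K} (h : f.ext = g.ext)
    (hInv : f.extInv = g.extInv) : f = g := by
  have hhomeo : f.toHomeo = g.toHomeo := Homeomorph.ext fun x => Subtype.ext <| by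
    have hx : edist (complexify (f.toHomeo x : EvenSpace ℝ n)) (complexify (g.toHomeo x)) = 0 := by
      rw [← f.ext_apply, ← g.ext_apply, h, edist_self]
    rwa [edist_complexify, edist_eq_zero] at hx
  cases f
  cases g
  simp_all

theorem holDist_le_iff {δ : ℝ≥0∞} : holDist K f g ≤ δ ↔
    (∀ z ∈ K, edist (f.ext z) (g.ext z) ≤ δ) ∧ ∀ z ∈ K, edist (f.extInv z) (g.extInv z) ≤ δ := by
  simp only [holDist, max_le_iff, iSup_le_iff]

theorem edist_ext_le_holDist {z : EvenSpace ℂ n} (hz : z ∈ K) :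
    edist (f.ext z) (g.ext z) ≤ holDist K f g := (holDist_le_iff.1 le_rfl).1 z hz

theorem edist_extInv_le_holDist {z : EvenSpace ℂ n} (hz : z ∈ K) :
    edist (f.extInv z) (g.extInv z) ≤ holDist K f g := (holDist_le_iff.1 le_rfl).2 z hz

theorem edist_toHomeo_le_holDist (hK : ∀ x : OddSphere n, complexify x ∈ K) (x : OddSphere n) :
    edist (f.toHomeo x) (g.toHomeo x) ≤ holDist K f g := by
  rw [Subtype.edist_eq, ← edist_complexify, ← f.ext_apply, ← g.ext_apply]
  exact edist_ext_le_holDist (hK x)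

theorem edist_toHomeo_symm_le_holDist (hK : ∀ x : OddSphere n, complexify x ∈ K)
    (x : OddSphere n) : edist (f.toHomeo.symm x) (g.toHomeo.symm x) ≤ holDist K f g := by
  rw [Subtype.edist_eq, ← edist_complexify, ← f.extInv_apply, ← g.extInv_apply]
  exact edist_extInv_le_holDist (hK x)

theorem holDist_self (f : HolDiffeo n L) : holDist K f f = 0 := by
  simp [holDist]

theorem holDist_comm (f : HolDiffeo n L) (g : HolDiffeo n M) :
    holDist K f g = holDist K g f := by
  simp only [holDist, edist_comm]

theorem holDist_triangle (f : HolDiffeo n L) (g : HolDiffeo n M) (h : HolDiffeo n N) :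
    holDist K f h ≤ holDist K f g + holDist K g h :=
  holDist_le_iff.2
    ⟨fun _ hz => (edist_triangle _ _ _).trans
      (add_le_add (edist_ext_le_holDist hz) (edist_ext_le_holDist hz)),
    fun _ hz => (edist_triangle _ _ _).trans
      (add_le_add (edist_extInv_le_holDist hz) (edist_extInv_le_holDist hz))⟩

theorem holDist_mono {K' : Set (EvenSpace ℂ n)} (hK : K ⊆ K') (f : HolDiffeo n L)
    (g : HolDiffeo n M) : holDist K f g ≤ holDist K' f g :=
  max_le_max (biSup_mono hK) (biSup_mono hK)

theorem holDist_le_of_nested {a : ℕ → HolDiffeo n L} {δ : ℕ → ℝ≥0∞}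
    (ha : ∀ k, holDist K (a (k + 1)) (a k) + δ (k + 1) ≤ δ k) {k l : ℕ} (hkl : k ≤ l) :
    holDist K (a l) (a k) ≤ δ k := by
  suffices holDist K (a l) (a k) + δ l ≤ δ k from le_self_add.trans this
  induction l, hkl using Nat.le_induction with
  | base => simp [holDist_self]
  | succ l _ ih =>
    calc holDist K (a (l + 1)) (a k) + δ (l + 1)
        ≤ holDist K (a (l + 1)) (a l) + holDist K (a l) (a k) + δ (l + 1) := by
          gcongr
          exact holDist_triangle _ _ _
      _ = holDist K (a l) (a k) + (holDist K (a (l + 1)) (a l) + δ (l + 1)) := by ring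
      _ ≤ holDist K (a l) (a k) + δ l := by gcongr; exact ha l
      _ ≤ δ k := ih

theorem exists_holDiffeo_of_nested {U : Set (EvenSpace ℂ n)} (hU : IsOpen U)
    (hsphere : ∀ x : OddSphere n, complexify x ∈ U) (hKU : K ⊆ U) {a : ℕ → EntDiffeo n}
    {δ : ℕ → ℝ≥0∞} (hδ : Tendsto δ atTop (𝓝 0))
    (ha : ∀ k, holDist U (a (k + 1)) (a k) + δ (k + 1) ≤ δ k) :
    ∃ f : HolDiffeo n K, ∀ k, holDist U f (a k) ≤ δ k := by
  have hcauchy (k l : ℕ) (hkl : k ≤ l) : holDist U (a l) (a k) ≤ δ k :=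
    holDist_le_of_nested ha hkl
  obtain ⟨Φ, hΦ, hΦbound⟩ := exists_tendstoUniformlyOn_of_edist_le hδ fun k l hkl z hz =>
    (edist_ext_le_holDist (f := a l) (g := a k) hz).trans (hcauchy k l hkl)
  obtain ⟨Ψ, hΨ, hΨbound⟩ := exists_tendstoUniformlyOn_of_edist_le hδ fun k l hkl z hz =>
    (edist_extInv_le_holDist (f := a l) (g := a k) hz).trans (hcauchy k l hkl)
  obtain ⟨h, hh, hsymm⟩ := exists_homeomorph_tendstoUniformly hδ
    (fun k l hkl x =>
      (edist_toHomeo_le_holDist (f := a l) (g := a k) hsphere x).trans (hcauchy k l hkl))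
    fun k l hkl x =>
      (edist_toHomeo_symm_le_holDist (f := a l) (g := a k) hsphere x).trans (hcauchy k l hkl)
  have hcont : Continuous fun x : OddSphere n => complexify (x : EvenSpace ℝ n) :=
    (Isometry.continuous edist_complexify).comp continuous_subtype_val
  let f : HolDiffeo n K :=
    { toHomeo := h
      ext := Φ
      extInv := Ψ
      holo_ext := ⟨U, hU, hKU, differentiableOn_of_tendstoUniformlyOn hU
        (fun k => (a k).holo_ext.differentiable.differentiableOn) hΦ⟩
      holo_extInv := ⟨U, hU, hKU, differentiableOn_of_tendstoUniformlyOn hU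
        (fun k => (a k).holo_extInv.differentiable.differentiableOn) hΨ⟩
      ext_apply := fun x => tendsto_nhds_unique (hΦ.tendsto_at (hsphere x)) <| by
        simpa only [(a _).ext_apply, Function.comp_def] using
          (hcont.tendsto _).comp (hh.tendsto_at x)
      extInv_apply := fun x => tendsto_nhds_unique (hΨ.tendsto_at (hsphere x)) <| by
        simpa only [(a _).extInv_apply, Function.comp_def] using
          (hcont.tendsto _).comp (hsymm.tendsto_at x) }
  exact ⟨f, fun k => holDist_le_iff.2 ⟨hΦbound k, hΨbound k⟩⟩

theorem volumePreserving_of_tendsto_holDist (hK : ∀ x : OddSphere n, complexify x ∈ K)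
    {a : ℕ → HolDiffeo n M} (ha : ∀ k, (a k).VolumePreserving)
    (hf : Tendsto (fun k => holDist K (a k) f) atTop (𝓝 0)) : f.VolumePreserving :=
  measurePreserving_of_tendsto ha fun x => tendsto_iff_edist_tendsto_0.2 <|
    tendsto_nhds_bot_mono' hf fun _ => edist_toHomeo_le_holDist hK x

end HolDist

section ConjFlow

variable {n : ℕ}

/-- The conjugate `H ∘ φ^t ∘ H⁻¹` of the circle action. -/
def conjFlow (H : EntDiffeo n) (t : ℝ) : EntDiffeo n :=
  EntDiffeo.comp (EntDiffeo.comp H (circleFlow n t)) (EntDiffeo.inv H)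

theorem conjFlow_ext (H : EntDiffeo n) (t : ℝ) (z : EvenSpace ℂ n) :
    (conjFlow H t).ext z = H.ext (planeRotation ℂ t (H.extInv z)) := rfl

theorem conjFlow_extInv (H : EntDiffeo n) (t : ℝ) : (conjFlow H t).extInv = (conjFlow H (-t)).ext :=
  rfl

theorem semiconj_conjFlow (H : EntDiffeo n) (t : ℝ) :
    Function.Semiconj H.toHomeo (circleAction n t) (conjFlow H t).toHomeo := fun x => by
  change _ = H.toHomeo (sphereRotation t (H.toHomeo.symm (H.toHomeo x)))
  rw [Homeomorph.symm_apply_apply, sphereRotation_eq_circleAction]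

theorem volumePreserving_conjFlow {H : EntDiffeo n} (hH : H.VolumePreserving) (t : ℝ) :
    (conjFlow H t).VolumePreserving := by
  have hinv : MeasurePreserving H.toHomeo.symm (sphereVolume n) (sphereVolume n) :=
    MeasurePreserving.symm H.toHomeo.toMeasurableEquiv hH
  exact (MeasurePreserving.comp (g := H.toHomeo) hH
    (isRegularDiffeo_circleFlow t).volumePreserving).comp hinv

theorem conjFlow_circleFlow_zero (t : ℝ) : conjFlow (circleFlow n 0) t = circleFlow n t :=
  HolDiffeo.eq_of_ext_eq
    (by ext1 z; simp [conjFlow_ext, circleFlow, planeRotation_zero])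
    (by ext1 z; simp [conjFlow_extInv, conjFlow_ext, circleFlow, planeRotation_zero])

theorem commute_planeRotation_neg {h : EvenSpace ℂ n → EvenSpace ℂ n} {t : ℝ}
    (hc : Function.Commute h (planeRotation ℂ t)) : Function.Commute h (planeRotation ℂ (-t)) :=
  Function.Semiconj.inverses_right hc
    (fun z => by rw [← planeRotation_add, add_neg_cancel, planeRotation_zero])
    (fun z => by rw [← planeRotation_add, neg_add_cancel, planeRotation_zero])

theorem conjFlow_comp (H : EntDiffeo n) {h : EntDiffeo n} (hh : IsRegularDiffeo h) {t : ℝ}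
    (hc : Function.Commute h.ext (planeRotation ℂ t)) :
    conjFlow (EntDiffeo.comp H h) t = conjFlow H t := by
  have hext {s : ℝ} (hs : Function.Commute h.ext (planeRotation ℂ s)) :
      (conjFlow (EntDiffeo.comp H h) s).ext = (conjFlow H s).ext := by
    ext1 z
    change H.ext (h.ext (planeRotation ℂ s (h.extInv (H.extInv z)))) = _
    rw [hs.eq, hh.ext_extInv, conjFlow_ext]
  refine HolDiffeo.eq_of_ext_eq (hext hc) ?_
  rw [conjFlow_extInv, conjFlow_extInv, hext (commute_planeRotation_neg hc)]

theorem eventually_forall_edist_le_of_isCompact {T X Y : Type*} [TopologicalSpace T]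
    [TopologicalSpace X] [PseudoEMetricSpace Y] {G : T → X → Y}
    (hG : Continuous fun p : T × X => G p.1 p.2) {K : Set X} (hK : IsCompact K) (t₀ : T)
    {ε : ℝ≥0∞} (hε : 0 < ε) : ∀ᶠ t in 𝓝 t₀, ∀ x ∈ K, edist (G t x) (G t₀ x) ≤ ε := by
  refine hK.eventually_forall_of_forall_eventually fun x _ => ?_
  have hedist : Continuous fun p : T × X => edist (G p.1 p.2) (G t₀ p.2) :=
    hG.edist (hG.comp (continuous_const.prodMk continuous_snd))
  exact (hedist.tendsto (t₀, x)).eventually_le_const (by simpa using hε)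

theorem continuous_conjFlow_ext (H : EntDiffeo n) :
    Continuous fun p : ℝ × EvenSpace ℂ n => (conjFlow H p.1).ext p.2 := by
  have hH := H.holo_ext.differentiable.continuous
  have hH' := H.holo_extInv.differentiable.continuous
  have hJ := (quarterTurn ℂ n).continuous_of_finiteDimensional
  simp only [conjFlow_ext, planeRotation_eq_rotationMap, rotationMap_apply]
  fun_prop

theorem tendsto_holDist_conjFlow (H : EntDiffeo n) {K : Set (EvenSpace ℂ n)}
    (hK : Bornology.IsBounded K) (t₀ : ℝ) :
    Tendsto (fun t => holDist K (conjFlow H t) (conjFlow H t₀)) (𝓝 t₀) (𝓝 0) := by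
  refine ENNReal.tendsto_nhds_zero.2 fun ε hε => ?_
  have hext (s : ℝ) := eventually_forall_edist_le_of_isCompact
    (G := fun t z => (conjFlow H t).ext z) (continuous_conjFlow_ext H)
    hK.isCompact_closure s hε
  filter_upwards [hext t₀, (continuous_neg.tendsto t₀).eventually (hext (-t₀))] with t ht ht'
    using holDist_le_iff.2
      ⟨fun z hz => ht z (subset_closure hz), fun z hz => ht' z (subset_closure hz)⟩

theorem eventually_hasNearlyConstantMeans_conjFlow (H : EntDiffeo n) {F : C(OddSphere n, ℝ)}
    {c δ η : ℝ} (hc : ∀ x, |(∫ t, F (H.toHomeo (circleAction n t x))) - c| ≤ δ) (hδ : δ < η)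
    (α : ℚ) : ∀ᶠ r : ℕ in atTop,
      HasNearlyConstantMeans (conjFlow H (α + 1 / (α.den * r) : ℚ)).toHomeo F η := by
  have hFH : ∀ x, |orbitAvg (circleAction n) (F.comp H.toHomeo) x - c| ≤ δ := by
    simpa [orbitAvg_apply] using hc
  filter_upwards [eventually_hasNearlyConstantMeans_flow (circleAction n) hFH hδ] with r hr
  refine (hr _ α.den ?_).of_semiconj (semiconj_conjFlow H _) H.toHomeo.surjective
  have hden : (α.den : ℚ) ≠ 0 := Nat.cast_ne_zero.2 α.den_nz
  have hrot : α.den * (α + 1 / (α.den * r) : ℚ) = α.num + 1 / r := by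
    rw [mul_add, mul_comm, Rat.mul_den_eq_num, ← div_div, mul_div_assoc',
      mul_one_div_cancel hden]
  have hrot' : (α.den • ((α + 1 / (α.den * r) : ℚ) : ℝ) : ℝ) = α.num • (1 : ℝ) + 1 / r := by
    rw [nsmul_eq_mul, zsmul_one]
    simpa only [Rat.cast_mul, Rat.cast_add, Rat.cast_div, Rat.cast_natCast, Rat.cast_intCast,
      Rat.cast_one] using congrArg (Rat.cast : ℚ → ℝ) hrot
  rw [← AddCircle.coe_nsmul, hrot', AddCircle.coe_add, AddCircle.coe_zsmul, AddCircle.coe_period,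
    smul_zero, zero_add]

-- Replacing `H` by `H ∘ h` leaves the periodic map `H ∘ φ^α ∘ H⁻¹` unchanged, and for `α'` close
-- to `α` the orbits of `φ^α'` follow those of `φ`, along which the mean of `F ∘ H ∘ h` is almost
-- constant.
theorem exists_conjFlow_near_hasNearlyConstantMeans {H : EntDiffeo n} (hH : IsRegularDiffeo H)
    (α : ℚ) {K : Set (EvenSpace ℂ n)} (hK : Bornology.IsBounded K) {δ : ℝ≥0∞} (hδ : 0 < δ)
    (F : C(OddSphere n, ℝ)) {η : ℝ} (hη : 0 < η) :
    ∃ (H' : EntDiffeo n) (α' : ℚ), IsRegularDiffeo H' ∧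
      holDist K (conjFlow H' α') (conjFlow H α) ≤ δ ∧
      HasNearlyConstantMeans (conjFlow H' α').toHomeo F η := by
  obtain ⟨h, hh, hcomm, c, hc⟩ :=
    exists_isRegularDiffeo_avg_near_const (F.comp (H.toHomeo : C(OddSphere n, OddSphere n)))
      (half_pos hη) α
  set H' := EntDiffeo.comp H h
  have hseq : Tendsto (fun r : ℕ => ((α + 1 / (α.den * r) : ℚ) : ℝ)) atTop (𝓝 α) := by
    have := (tendsto_one_div_atTop_nhds_zero_nat.const_mul (1 / (α.den : ℝ))).const_add (α : ℝ)
    simpa [mul_comm] using this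
  have hnear := ((tendsto_holDist_conjFlow H' hK α).comp hseq).eventually_le_const hδ
  obtain ⟨r, hr, hmeans⟩ := (hnear.and
    (eventually_hasNearlyConstantMeans_conjFlow H' hc (half_lt_self hη) α)).exists
  refine ⟨H', _, hH.comp hh, ?_, hmeans⟩
  rwa [← conjFlow_comp H hh hcomm]

end ConjFlow

section Stages

variable {n : ℕ}

theorem uniquelyErgodic_and_minimalHomeo_of_hasNearlyConstantMeans [Nonempty (Fin n)]
    {f : OddSphere n ≃ₜ OddSphere n} (hf : MeasurePreserving f (sphereVolume n) (sphereVolume n))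
    (h : ∀ (F : C(OddSphere n, ℝ)) (η : ℝ), 0 < η → HasNearlyConstantMeans f F η) :
    UniquelyErgodic f ∧ MinimalHomeo f := by
  have : NeZero (sphereVolume n) := ⟨Measure.toSphere_ne_zero _⟩
  set c := (sphereVolume n Set.univ)⁻¹
  have : (c • sphereVolume n).IsOpenPosMeasure :=
    Measure.isOpenPosMeasure_smul _ (ENNReal.inv_ne_zero.2 (measure_ne_top _ _))
  have hfc : MeasurePreserving f (c • sphereVolume n) (c • sphereVolume n) := hf.smul_measure c
  exact ⟨uniquelyErgodic_of_hasNearlyConstantMeans f.continuous hfc h,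
    minimalHomeo_of_hasNearlyConstantMeans hfc h⟩

/-- A stage of the construction: the periodic map `conj ∘ φ^rot ∘ conj⁻¹` together with the
distance `tol` that the limit may keep from it. -/
structure Stage (n : ℕ) where
  conj : EntDiffeo n
  rot : ℚ
  tol : ℝ≥0∞
  regular : IsRegularDiffeo conj
  tol_pos : 0 < tol

/-- The periodic map of a stage. -/
def Stage.map (s : Stage n) : EntDiffeo n := conjFlow s.conj s.rot

theorem Stage.exists_next (s : Stage n) {K : Set (EvenSpace ℂ n)} (hK : Bornology.IsBounded K)
    (F : C(OddSphere n, ℝ)) {η : ℝ} (hη : 0 < η) {b : ℝ≥0∞} (hb : 0 < b) :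
    ∃ s' : Stage n, s'.tol ≤ b ∧ holDist K s'.map s.map + s'.tol ≤ s.tol ∧
      ∀ g : C(OddSphere n, OddSphere n), (∀ x, edist (g x) (s'.map.toHomeo x) ≤ s'.tol) →
        HasNearlyConstantMeans g F η := by
  have hhalf : 0 < s.tol / 2 := ENNReal.half_pos s.tol_pos.ne'
  obtain ⟨H, α, hH, hnear, hmeans⟩ :=
    exists_conjFlow_near_hasNearlyConstantMeans s.regular s.rot hK hhalf F hη
  obtain ⟨δ, hδ, hstable⟩ := exists_pos_hasNearlyConstantMeans_of_edist_le
    (f := ((conjFlow H α).toHomeo : C(OddSphere n, OddSphere n))) hmeans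
  refine ⟨⟨H, α, min (min δ b) (s.tol / 2), hH, lt_min (lt_min hδ hb) hhalf⟩,
    (min_le_left _ _).trans (min_le_right _ _), ?_, fun g hg => hstable g fun x =>
      (hg x).trans ((min_le_left _ _).trans (min_le_left _ _))⟩
  exact (add_le_add hnear (min_le_right _ _)).trans_eq (ENNReal.add_halves _)

theorem exists_stage_near_circleFlow {K : Set (EvenSpace ℂ n)} (hK : Bornology.IsBounded K) (t₀ : ℝ)
    {ε : ℝ≥0∞} (hε : 0 < ε) :
    ∃ s : Stage n, s.tol + holDist K s.map (circleFlow n t₀) < ε := by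
  obtain ⟨δ, hδ, hδε⟩ := exists_between hε
  have hnear := (tendsto_holDist_conjFlow (circleFlow n 0) hK t₀).eventually_lt_const
    (tsub_pos_of_lt hδε)
  simp only [conjFlow_circleFlow_zero] at hnear
  obtain ⟨q, hq⟩ := Rat.denseRange_cast.mem_nhds hnear
  refine ⟨⟨circleFlow n 0, q, δ, isRegularDiffeo_circleFlow 0, hδ⟩, ?_⟩
  rw [Stage.map, conjFlow_circleFlow_zero]
  exact lt_tsub_iff_left.1 hq

theorem exists_stage_sequence {K : Set (EvenSpace ℂ n)} (hK : Bornology.IsBounded K) (t₀ : ℝ)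
    {ε : ℝ≥0∞} (hε : 0 < ε) :
    ∃ S : ℕ → Stage n, (S 0).tol + holDist K (S 0).map (circleFlow n t₀) < ε ∧
      Tendsto (fun k => (S k).tol) atTop (𝓝 0) ∧
      (∀ k, holDist K (S (k + 1)).map (S k).map + (S (k + 1)).tol ≤ (S k).tol) ∧
      ∀ g : C(OddSphere n, OddSphere n),
        (∀ k x, edist (g x) ((S k).map.toHomeo x) ≤ (S k).tol) →
        ∀ (F : C(OddSphere n, ℝ)) (η : ℝ), 0 < η → HasNearlyConstantMeans g F η := by
  let Q := TopologicalSpace.denseSeq (C(OddSphere n, ℝ) × Set.Ioi (0 : ℝ))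
  have hQ : DenseRange Q := TopologicalSpace.denseRange_denseSeq _
  obtain ⟨s₀, hs₀⟩ := exists_stage_near_circleFlow hK t₀ hε
  choose next htol hnested hmeans using fun (k : ℕ) (s : Stage n) =>
    s.exists_next hK (Q k).1 (Q k).2.2 (ENNReal.inv_pos.2 (ENNReal.natCast_ne_top k))
  let S : ℕ → Stage n := fun k => Nat.rec s₀ next k
  refine ⟨S, hs₀, ?_, fun k => hnested k (S k), fun g hg F η hη =>
    hasNearlyConstantMeans_of_denseRange hQ (fun k => hmeans k (S k) g (hg (k + 1))) F hη⟩
  rw [← tendsto_add_atTop_iff_nat 1]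
  exact tendsto_nhds_bot_mono' ENNReal.tendsto_inv_nat_nhds_zero fun k => htol k (S k)

end Stages

end

theorem theorem1 (n : ℕ) (hn : 1 ≤ n) (t₀ : ℝ) (ht₀ : t₀ ∈ Set.Icc (0 : ℝ) 1)
    (ε : ℝ) (hε : 0 < ε) (Δ : ℝ) (hΔ : 0 < Δ) :
    ∃ f : HolDiffeo n (extBall n Δ),
      f.VolumePreserving ∧
      UniquelyErgodic f.toHomeo ∧
      MinimalHomeo f.toHomeo ∧
      holDist (extBall n Δ) f (circleFlow n t₀) < ENNReal.ofReal ε ∧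
      ∃ (H : ℕ → EntDiffeo n) (t : ℕ → ℝ),
        (∀ k, (H k).VolumePreserving) ∧
        Tendsto
          (fun k => holDist (extBall n Δ)
            (((H k).comp (circleFlow n (t k))).comp (H k).inv) f)
          atTop (𝓝 0) := by
  have : Nonempty (Fin n) := Fin.pos_iff_nonempty.1 hn
  let U : Set (EvenSpace ℂ n) := Metric.ball 0 (max Δ 1 + 1)
  have hBU : extBall n Δ ⊆ U := Metric.closedBall_subset_ball (lt_add_one _)
  have hsphere (x : OddSphere n) : complexify (x : EvenSpace ℝ n) ∈ U :=
    complexify_mem_ball ((le_max_right Δ 1).trans_lt (lt_add_one _)) x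
  obtain ⟨S, hS₀, htol, hnested, hmeans⟩ := exists_stage_sequence
    (Metric.isBounded_ball : Bornology.IsBounded U) t₀ (ENNReal.ofReal_pos.2 hε)
  obtain ⟨f, hf⟩ := exists_holDiffeo_of_nested (a := fun k => (S k).map) Metric.isOpen_ball
    hsphere hBU htol hnested
  have hlim : Tendsto (fun k => holDist U (S k).map f) atTop (𝓝 0) :=
    tendsto_nhds_bot_mono' htol fun k => (holDist_comm _ _).trans_le (hf k)
  have hvol : f.VolumePreserving := volumePreserving_of_tendsto_holDist hsphere
    (fun k => volumePreserving_conjFlow (S k).regular.volumePreserving _) hlim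
  obtain ⟨huniq, hmin⟩ := uniquelyErgodic_and_minimalHomeo_of_hasNearlyConstantMeans hvol <|
    hmeans f.toHomeo fun k x => (edist_toHomeo_le_holDist hsphere x).trans (hf k)
  refine ⟨f, hvol, huniq, hmin, ?_, fun k => (S k).conj, fun k => (S k).rot,
    fun k => (S k).regular.volumePreserving,
    tendsto_nhds_bot_mono' hlim fun k => holDist_mono hBU _ _⟩
  calc holDist (extBall n Δ) f (circleFlow n t₀)
      ≤ holDist U f (circleFlow n t₀) := holDist_mono hBU _ _
    _ ≤ holDist U f (S 0).map + holDist U (S 0).map (circleFlow n t₀) := holDist_triangle _ _ _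
    _ ≤ (S 0).tol + holDist U (S 0).map (circleFlow n t₀) := add_le_add_left (hf 0) _
    _ < ENNReal.ofReal ε := hS₀
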